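/- **Theorem.** Let $N\ge 1$, let $\Omega\subseteq\mathbb{R}^N$ be a bounded open set with Lipschitz boundary, and let $U\subseteq\mathbb{R}^N$ be an open set such that $\Omega\Subset U$, i.e. $\overline\Omega$ is compact and $\overline\Omega\subseteq U$. Let $p,q,\varkappa$ be real numbers with $\varkappa>0$ and $$1\le p\le q\le p+\varkappa\max\left(1,\frac pN\right).$$ Let $a:\Omega\to[0,\infty)$ be a measurable function of the form $a=\sigma\omega$ on $\Omega$, where * $\sigma\in\mathcal Z^{\varkappa}(\Omega)$, i.e. $\sigma:\Omega\to[0,\infty)$ and there is a constant $C$ such that $\sigma(x)\le C\left(\sigma(y)+|x-y|^{\varkappa}\right)$ for all $x,y\in\Omega$; * $\omega\in L^\infty(\Omega)$ and, if $q>1$, $\omega\in A_q(U)$, i.e. $\omega:U\to[0,\infty)$ is measurable and $$\sup_{B\subseteq U}\left(\frac1{|B|}\int_B\omega\,dz\right)\left(\frac1{|B|}\int_B\omega^{-\frac1{q-1}}\,dz\right)^{q-1}<\infty,$$ where the supremum is over all balls $B$ contained in $U$ (with $0^{-1/(q-1)}=\infty$ and $0\cdot\infty=0$). If $q=1$, no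 Muckenhoupt condition is imposed on $\omega$. For $u\in W^{1,1}(\Omega)$ let $$\mathcal F[u]=\int_\Omega\left(|\nabla u|^p+a(x)|\nabla u|^q\right)dx\in[0,\infty].$$ Then, for every $u_0\in W^{1,1}(\Omega)$ with $\mathcal F[u_0]<\infty$, $$\inf_{u\in u_0+W^{1,1}_0(\Omega)}\mathcal F[u]=\inf_{u\in u_0+C_c^\infty(\Omega)}\mathcal F[u],$$ where $W^{1,1}_0(\Omega)$ is the closure of $C_c^\infty(\Omega)$ in $W^{1,1}(\Omega)$. -/

import Mathlib

open MeasureTheory Metric Set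
open scoped ENNReal NNReal

/-- The Euclidean space `ℝ^N`. -/
abbrev Eucl (N : ℕ) : Type := EuclideanSpace ℝ (Fin N)

/-- `φ ∈ C_c^∞(Ω)`: a smooth function with compact support contained in `Ω`. -/
def IsTestFunction {N : ℕ} (Ω : Set (Eucl N)) (φ : Eucl N → ℝ) : Prop :=
  ContDiff ℝ (⊤ : ℕ∞) φ ∧ HasCompactSupport φ ∧ tsupport φ ⊆ Ω

/-- `G` is a weak (distributional) gradient of `u` on `Ω`:
`∫_Ω u ∂_i φ = - ∫_Ω φ G_i` for all `φ ∈ C_c^∞(Ω)` and all `i`. -/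
def IsWeakGradient {N : ℕ} (Ω : Set (Eucl N)) (u : Eucl N → ℝ) (G : Eucl N → Eucl N) : Prop :=
  LocallyIntegrableOn u Ω ∧ LocallyIntegrableOn G Ω ∧
    ∀ φ : Eucl N → ℝ, IsTestFunction Ω φ → ∀ i : Fin N,
      ∫ x in Ω, u x * fderiv ℝ φ x (EuclideanSpace.single i 1) = -∫ x in Ω, φ x * G x i

open Classical in
/-- The weak gradient `∇u` of `u` on the open set `Ω`, determined up to a null subset of `Ω`
(and set to `0` if `u` has no weak gradient; it is only used for `u ∈ W^{1,1}(Ω)`). -/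
noncomputable def weakGradient {N : ℕ} (Ω : Set (Eucl N)) (u : Eucl N → ℝ) : Eucl N → Eucl N :=
  if h : ∃ G, IsWeakGradient Ω u G then h.choose else 0

/-- `u ∈ W^{1,1}(Ω)`. -/
def MemW11 {N : ℕ} (Ω : Set (Eucl N)) (u : Eucl N → ℝ) : Prop :=
  IntegrableOn u Ω ∧ ∃ G, IsWeakGradient Ω u G ∧ IntegrableOn G Ω

/-- The norm `‖u‖_{L^1(Ω)} + ‖∇u‖_{L^1(Ω)}` of `u ∈ W^{1,1}(Ω)`. -/
noncomputable def normW11 {N : ℕ} (Ω : Set (Eucl N)) (u : Eucl N → ℝ) : ℝ≥0∞ :=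
  (∫⁻ x in Ω, ‖u x‖ₑ) + ∫⁻ x in Ω, ‖weakGradient Ω u x‖ₑ

/-- `u ∈ W^{1,1}_0(Ω)`, the closure of `C_c^∞(Ω)` in `W^{1,1}(Ω)`. -/
def MemW11Zero {N : ℕ} (Ω : Set (Eucl N)) (u : Eucl N → ℝ) : Prop :=
  MemW11 Ω u ∧ ∀ ε : ℝ≥0∞, 0 < ε → ∃ φ, IsTestFunction Ω φ ∧ normW11 Ω (u - φ) < ε

/-- The double phase functional `F[u; Ω] = ∫_Ω (|∇u|^p + a |∇u|^q) dx ∈ [0, ∞]`. -/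
noncomputable def doublePhase {N : ℕ} (Ω : Set (Eucl N)) (a : Eucl N → ℝ) (p q : ℝ)
    (u : Eucl N → ℝ) : ℝ≥0∞ :=
  ∫⁻ x in Ω, ENNReal.ofReal (‖weakGradient Ω u x‖ ^ p + a x * ‖weakGradient Ω u x‖ ^ q)

/-- `σ ∈ Z^ϰ(Ω)`: `σ ≥ 0` and `σ(x) ≤ C (σ(y) + |x - y|^ϰ)` for all `x, y ∈ Ω`. -/
def MemZ {N : ℕ} (κ : ℝ) (Ω : Set (Eucl N)) (σ : Eucl N → ℝ) : Prop :=
  (∀ x ∈ Ω, 0 ≤ σ x) ∧ ∃ C : ℝ, ∀ x ∈ Ω, ∀ y ∈ Ω, σ x ≤ C * (σ y + ‖x - y‖ ^ κ)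

/-- `ω ∈ A_r(U)` for `1 < r < ∞`, the local Muckenhoupt class over the balls contained in `U`.
The averages take values in `[0, ∞]`, and `ω ^ (-1/(r-1)) = ∞` where `ω = 0`. -/
def MemMuckenhoupt {N : ℕ} (r : ℝ) (U : Set (Eucl N)) (ω : Eucl N → ℝ) : Prop :=
  (∀ x ∈ U, 0 ≤ ω x) ∧ AEMeasurable ω (volume.restrict U) ∧
    ∃ C : ℝ≥0, ∀ (x : Eucl N) (ρ : ℝ), 0 < ρ → ball x ρ ⊆ U →
      (⨍⁻ z in ball x ρ, ENNReal.ofReal (ω z) ∂volume) *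
        (⨍⁻ z in ball x ρ, ENNReal.ofReal (ω z) ^ (-(1 / (r - 1))) ∂volume) ^ (r - 1) ≤ C

/-- A bounded open set with Lipschitz boundary: near every boundary point, and for a suitable
direction `e`, the set is the part above the graph of a Lipschitz function `γ` defined on the
hyperplane orthogonal to `e` (only the values of `γ` on that hyperplane matter). -/
def IsBoundedLipschitzDomain {N : ℕ} (Ω : Set (Eucl N)) : Prop :=
  IsOpen Ω ∧ Bornology.IsBounded Ω ∧
    ∀ x₀ ∈ frontier Ω, ∃ (e : Eucl N) (γ : Eucl N → ℝ) (L : ℝ≥0) (r : ℝ),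
      ‖e‖ = 1 ∧ LipschitzWith L γ ∧ 0 < r ∧
        ∀ y ∈ ball x₀ r, (y ∈ Ω ↔ γ (y - inner ℝ e y • e) < inner ℝ e y)

/-!
Test functions belong to `W^{1,1}_0(Ω)`, so the infimum over `W^{1,1}_0(Ω)` is at most the one over
test functions, and only the converse inequality needs an argument. The energy is convex and
doubling, hence it suffices (see `iInf_doublePhase_eq_of_approxByTest`) that every
`v ∈ W^{1,1}_0(Ω)` of finite energy is a limit *in energy* of test functions: `F[v - φ_n] → 0`. The
perturbation `φ_n - v` of `u₀ + v` is then absorbed by convexity.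

The approximation proceeds by reduction to an easy geometric situation.
* `MemW11Zero.isWeakGradient_indicator_comp` and `tendsto_dpEnergy_truncation` replace `v` by
  `k arctan (v / k)`, extended by zero to the whole space; so `v` may be assumed bounded.
* A partition of unity (`approxByTest_of_bounded`) localizes to balls in which, by the Lipschitz
  property, `Ω` can be pushed into itself along a fixed direction `e`
  (`IsBoundedLipschitzDomain.exists_push`). Mollification at scale `δ` with a kernel concentrated
  near `e` then yields test functions on `Ω`.

The heart of the matter is that these mollifications converge in energy (`approxByTest_of_push`).
Their gradients are averages `S` of the weak gradient `H` over balls of radius comparable to `δ`.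
If `σ(x)` is at most of order `δ^ϰ`, then `σ(x) S^q` is bounded by `S^p` times `δ^ϰ S^(q-p)`, which
is bounded: `S` is of order `δ⁻¹` as `v` is bounded, and of order `δ^(-N/p)` as `H ∈ L^p`, and this
is where the bound on `q` enters (`IsMollifier.exists_rpow_mul_gradient_le`). Otherwise the
condition defining `Z^ϰ` bounds `σ(x)` by a multiple of `σ` on the whole ball, so that `σ^(1/q)` can
be moved inside the average (`weight_mul_rpow_le`), and `σ ω S^q` is bounded by `ω` times the
`q`-th power of the average of `σ^(1/q) |H| ∈ L^q(ω)`. Averages over balls of a fixed radius are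
bounded on `L^q(ω)` when `ω ∈ A_q`, by Hölder's inequality and Fubini's theorem
(`lintegral_weight_mul_rpow_lintegral_ball_le`); no maximal theorem is needed. Splitting off large
values shows that these averages are uniformly integrable (`exists_average_le_const_add`), and
convergence at Lebesgue points gives convergence in energy.

If `q = 1`, then `p = q = 1` and `a` is bounded, so the energy is controlled by the norm of `W^{1,1}`
and no condition on `ω` beyond boundedness is needed (`approxByTest_of_eq_one`).
-/

/-! ### Weak gradients -/

theorem gradient_apply_eq_fderiv {N : ℕ} (φ : Eucl N → ℝ) (x : Eucl N) (i : Fin N) :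
    gradient φ x i = fderiv ℝ φ x (EuclideanSpace.single i 1) := by
  have h := InnerProductSpace.toDual_symm_apply (𝕜 := ℝ) (x := EuclideanSpace.single i (1 : ℝ))
    (y := fderiv ℝ φ x)
  rw [EuclideanSpace.inner_single_right] at h
  simpa [gradient] using h

theorem norm_gradient_eq {N : ℕ} (φ : Eucl N → ℝ) (x : Eucl N) :
    ‖gradient φ x‖ = ‖fderiv ℝ φ x‖ := by
  simp [gradient]

theorem ContDiff.continuous_gradient {N : ℕ} {φ : Eucl N → ℝ} (h : ContDiff ℝ 1 φ) :
    Continuous (gradient φ) :=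
  (InnerProductSpace.toDual ℝ (Eucl N)).symm.continuous.comp (h.continuous_fderiv one_ne_zero)

theorem IsTestFunction.contDiff_one {N : ℕ} {Ω : Set (Eucl N)} {φ : Eucl N → ℝ}
    (h : IsTestFunction Ω φ) : ContDiff ℝ 1 φ :=
  h.1.of_le (by exact_mod_cast le_top)

theorem IsTestFunction.continuous_fderiv_apply {N : ℕ} {Ω : Set (Eucl N)} {φ : Eucl N → ℝ}
    (h : IsTestFunction Ω φ) (e : Eucl N) : Continuous fun x => fderiv ℝ φ x e :=
  (h.contDiff_one.continuous_fderiv one_ne_zero).clm_apply continuous_const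

theorem IsTestFunction.hasCompactSupport_fderiv_apply {N : ℕ} {Ω : Set (Eucl N)} {φ : Eucl N → ℝ}
    (h : IsTestFunction Ω φ) (e : Eucl N) : HasCompactSupport fun x => fderiv ℝ φ x e :=
  h.2.1.fderiv_apply (𝕜 := ℝ) e

theorem fderiv_apply_eq_zero_of_notMem_tsupport {N : ℕ} {φ : Eucl N → ℝ} {x : Eucl N}
    (h : x ∉ tsupport φ) (e : Eucl N) : fderiv ℝ φ x e = 0 := by
  have : x ∉ Function.support (fderiv ℝ φ) := fun hx => h (support_fderiv_subset ℝ hx)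
  rw [Function.notMem_support] at this
  simp [this]

theorem IsTestFunction.zero {N : ℕ} {Ω : Set (Eucl N)} : IsTestFunction Ω (0 : Eucl N → ℝ) :=
  ⟨contDiff_const, HasCompactSupport.zero, by simp [tsupport]⟩

theorem IsTestFunction.add {N : ℕ} {Ω : Set (Eucl N)} {φ ψ : Eucl N → ℝ}
    (h : IsTestFunction Ω φ) (h' : IsTestFunction Ω ψ) : IsTestFunction Ω (φ + ψ) :=
  ⟨h.1.add h'.1, h.2.1.add h'.2.1, (tsupport_add φ ψ).trans (union_subset h.2.2 h'.2.2)⟩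

/-- A locally integrable function on an open set may be multiplied by a continuous function
whose compact support lies in that set. -/
theorem integrableOn_mul_of_hasCompactSupport {N : ℕ} {Ω : Set (Eucl N)}
    {u g : Eucl N → ℝ} (hu : LocallyIntegrableOn u Ω) (hg : Continuous g)
    (hgc : HasCompactSupport g) (hgs : tsupport g ⊆ Ω) :
    Integrable (fun x => u x * g x) (volume.restrict Ω) := by
  have h1 : IntegrableOn u (tsupport g) := hu.integrableOn_compact_subset hgs hgc
  have h2 : IntegrableOn (fun x => u x * g x) (tsupport g) :=
    h1.mul_continuousOn hg.continuousOn hgc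
  have : Integrable (fun x => u x * g x) := by
    rw [← integrableOn_iff_integrable_of_support_subset (s := tsupport g)]
    · exact h2
    · intro x hx
      exact subset_tsupport g (Function.support_mul_subset_right _ _ hx)
  exact this.restrict

theorem locallyIntegrableOn_euclidean_apply {N : ℕ} {Ω : Set (Eucl N)} {G : Eucl N → Eucl N}
    (h : LocallyIntegrableOn G Ω) (i : Fin N) : LocallyIntegrableOn (fun x => G x i) Ω := by
  intro x hx
  obtain ⟨s, hs, hi⟩ := h x hx
  exact ⟨s, hs, (EuclideanSpace.proj i : Eucl N →L[ℝ] ℝ).integrable_comp hi⟩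

theorem IsWeakGradient.add {N : ℕ} {Ω : Set (Eucl N)} {u v : Eucl N → ℝ}
    {G H : Eucl N → Eucl N} (hu : IsWeakGradient Ω u G) (hv : IsWeakGradient Ω v H) :
    IsWeakGradient Ω (u + v) (G + H) := by
  refine ⟨hu.1.add hv.1, hu.2.1.add hv.2.1, fun φ hφ i => ?_⟩
  have hd := hφ.continuous_fderiv_apply (EuclideanSpace.single i 1)
  have hdc := hφ.hasCompactSupport_fderiv_apply (EuclideanSpace.single i 1)
  have hds : tsupport (fun x => fderiv ℝ φ x (EuclideanSpace.single i 1)) ⊆ Ω :=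
    (tsupport_fderiv_apply_subset ℝ _).trans hφ.2.2
  have e1 := hu.2.2 φ hφ i
  have e2 := hv.2.2 φ hφ i
  have i1 := integrableOn_mul_of_hasCompactSupport hu.1 hd hdc hds
  have i2 := integrableOn_mul_of_hasCompactSupport hv.1 hd hdc hds
  have i3 := integrableOn_mul_of_hasCompactSupport (locallyIntegrableOn_euclidean_apply hu.2.1 i)
    hφ.1.continuous hφ.2.1 hφ.2.2
  have i4 := integrableOn_mul_of_hasCompactSupport (locallyIntegrableOn_euclidean_apply hv.2.1 i)
    hφ.1.continuous hφ.2.1 hφ.2.2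
  simp only [Pi.add_apply, add_mul, PiLp.add_apply, mul_add]
  rw [integral_add i1 i2, integral_add (by simpa only [mul_comm] using i3)
    (by simpa only [mul_comm] using i4), e1, e2]
  ring

theorem IsWeakGradient.neg {N : ℕ} {Ω : Set (Eucl N)} {u : Eucl N → ℝ}
    {G : Eucl N → Eucl N} (hu : IsWeakGradient Ω u G) : IsWeakGradient Ω (-u) (-G) := by
  refine ⟨hu.1.neg, hu.2.1.neg, fun φ hφ i => ?_⟩
  have e1 := hu.2.2 φ hφ i
  simp only [Pi.neg_apply, neg_mul, PiLp.neg_apply, mul_neg, integral_neg, e1]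

theorem IsWeakGradient.sub {N : ℕ} {Ω : Set (Eucl N)} {u v : Eucl N → ℝ}
    {G H : Eucl N → Eucl N} (hu : IsWeakGradient Ω u G) (hv : IsWeakGradient Ω v H) :
    IsWeakGradient Ω (u - v) (G - H) := by
  simpa only [sub_eq_add_neg] using hu.add hv.neg

/-- Weak gradients are unique up to null sets (fundamental lemma of the calculus of
variations). -/
theorem IsWeakGradient.ae_eq {N : ℕ} {Ω : Set (Eucl N)} (hΩ : IsOpen Ω) {u : Eucl N → ℝ}
    {G H : Eucl N → Eucl N} (hG : IsWeakGradient Ω u G) (hH : IsWeakGradient Ω u H) :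
    G =ᵐ[volume.restrict Ω] H := by
  have key : ∀ i : Fin N, ∀ᵐ x, x ∈ Ω → G x i - H x i = 0 := by
    intro i
    have hl : LocallyIntegrableOn (fun x => G x i - H x i) Ω :=
      (locallyIntegrableOn_euclidean_apply hG.2.1 i).sub
        (locallyIntegrableOn_euclidean_apply hH.2.1 i)
    refine hΩ.ae_eq_zero_of_integral_contDiff_smul_eq_zero hl fun g hg hgc hgs => ?_
    have hT : IsTestFunction Ω g := ⟨hg, hgc, hgs⟩
    have e1 := hG.2.2 g hT i
    have e2 := hH.2.2 g hT i
    have i3 := integrableOn_mul_of_hasCompactSupport (locallyIntegrableOn_euclidean_apply hG.2.1 i)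
      hg.continuous hgc hgs
    have i4 := integrableOn_mul_of_hasCompactSupport (locallyIntegrableOn_euclidean_apply hH.2.1 i)
      hg.continuous hgc hgs
    have : ∫ x, g x • (G x i - H x i) = ∫ x in Ω, g x • (G x i - H x i) := by
      refine (setIntegral_eq_integral_of_forall_compl_eq_zero fun x hx => ?_).symm
      rw [image_eq_zero_of_notMem_tsupport fun h => hx (hgs h), zero_smul]
    rw [this]
    simp only [smul_eq_mul, mul_sub]
    rw [integral_sub (by simpa only [mul_comm] using i3) (by simpa only [mul_comm] using i4)]
    linarith
  rw [Filter.EventuallyEq, ae_restrict_iff' hΩ.measurableSet]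
  filter_upwards [ae_all_iff.2 key] with x hx hxΩ
  ext i
  have := hx i hxΩ
  linarith

theorem weakGradient_ae_eq {N : ℕ} {Ω : Set (Eucl N)} (hΩ : IsOpen Ω) {u : Eucl N → ℝ}
    {G : Eucl N → Eucl N} (hG : IsWeakGradient Ω u G) :
    weakGradient Ω u =ᵐ[volume.restrict Ω] G := by
  have hex : ∃ G, IsWeakGradient Ω u G := ⟨G, hG⟩
  have : IsWeakGradient Ω u (weakGradient Ω u) := by
    rw [weakGradient, dif_pos hex]
    exact hex.choose_spec
  exact this.ae_eq hΩ hG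

/-- Integration by parts against a test function, for a `C^1` function. -/
theorem integral_mul_fderiv_eq_neg {N : ℕ} {f ψ : Eucl N → ℝ} (hf : ContDiff ℝ 1 f)
    (hψ : ContDiff ℝ 1 ψ) (hψc : HasCompactSupport ψ) (e : Eucl N) :
    ∫ x, f x * fderiv ℝ ψ x e = -∫ x, ψ x * fderiv ℝ f x e := by
  have cf : Continuous fun x => fderiv ℝ f x e :=
    (hf.continuous_fderiv one_ne_zero).clm_apply continuous_const
  have cψ : Continuous fun x => fderiv ℝ ψ x e :=
    (hψ.continuous_fderiv one_ne_zero).clm_apply continuous_const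
  rw [integral_mul_fderiv_eq_neg_fderiv_mul_of_integrable (μ := volume) (f := f) (g := ψ)]
  · simp only [mul_comm]
  · exact (cf.mul hψ.continuous).integrable_of_hasCompactSupport hψc.mul_left
  · exact (hf.continuous.mul cψ).integrable_of_hasCompactSupport
      (hψc.fderiv_apply (𝕜 := ℝ) e).mul_left
  · exact (hf.continuous.mul hψ.continuous).integrable_of_hasCompactSupport hψc.mul_left
  · exact fun x _ => hf.differentiable one_ne_zero x
  · exact fun x _ => hψ.differentiable one_ne_zero x

theorem ContDiff.isWeakGradient {N : ℕ} {f : Eucl N → ℝ} (hf : ContDiff ℝ 1 f)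
    (Ω : Set (Eucl N)) : IsWeakGradient Ω f (gradient f) := by
  refine ⟨hf.continuous.locallyIntegrable.locallyIntegrableOn _,
    hf.continuous_gradient.locallyIntegrable.locallyIntegrableOn _, fun ψ hψ i => ?_⟩
  have h := integral_mul_fderiv_eq_neg hf hψ.contDiff_one hψ.2.1 (EuclideanSpace.single i 1)
  rw [setIntegral_eq_integral_of_forall_compl_eq_zero,
    setIntegral_eq_integral_of_forall_compl_eq_zero, h]
  · simp only [gradient_apply_eq_fderiv]
  · intro x hx
    rw [image_eq_zero_of_notMem_tsupport fun h => hx (hψ.2.2 h), zero_mul]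
  · intro x hx
    rw [fderiv_apply_eq_zero_of_notMem_tsupport fun h => hx (hψ.2.2 h), mul_zero]

/-! ### The double phase energy of a vector field -/

/-- The double phase energy `∫_Ω (|G|^p + a |G|^q)` of an arbitrary vector field `G`, with the
weight `a` replaced by its positive part. -/
noncomputable def dpEnergy {N : ℕ} (Ω : Set (Eucl N)) (a : Eucl N → ℝ) (p q : ℝ)
    (G : Eucl N → Eucl N) : ℝ≥0∞ :=
  ∫⁻ x in Ω, (‖G x‖ₑ ^ p + ENNReal.ofReal (a x) * ‖G x‖ₑ ^ q)

theorem dpEnergy_congr {N : ℕ} {Ω : Set (Eucl N)} {a : Eucl N → ℝ} {p q : ℝ}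
    {G H : Eucl N → Eucl N} (h : G =ᵐ[volume.restrict Ω] H) :
    dpEnergy Ω a p q G = dpEnergy Ω a p q H := by
  refine lintegral_congr_ae ?_
  filter_upwards [h] with x hx
  rw [hx]

theorem dpEnergy_mono {N : ℕ} {Ω : Set (Eucl N)} {a : Eucl N → ℝ} {p q : ℝ}
    (hp : 0 ≤ p) (hq : 0 ≤ q) {G H : Eucl N → Eucl N}
    (h : ∀ᵐ x ∂volume.restrict Ω, ‖G x‖ₑ ≤ ‖H x‖ₑ) :
    dpEnergy Ω a p q G ≤ dpEnergy Ω a p q H := by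
  refine lintegral_mono_ae ?_
  filter_upwards [h] with x hx
  gcongr

theorem dpEnergy_neg {N : ℕ} {Ω : Set (Eucl N)} {a : Eucl N → ℝ} {p q : ℝ}
    (G : Eucl N → Eucl N) : dpEnergy Ω a p q (-G) = dpEnergy Ω a p q G := by
  simp [dpEnergy]

theorem doublePhase_eq_dpEnergy {N : ℕ} {Ω : Set (Eucl N)} (hΩ : IsOpen Ω) {a : Eucl N → ℝ}
    {p q : ℝ} (hp : 0 ≤ p) (hq : 0 ≤ q) (ha : ∀ x ∈ Ω, 0 ≤ a x) {u : Eucl N → ℝ}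
    {G : Eucl N → Eucl N} (hG : IsWeakGradient Ω u G) :
    doublePhase Ω a p q u = dpEnergy Ω a p q G := by
  refine lintegral_congr_ae ?_
  filter_upwards [weakGradient_ae_eq hΩ hG, ae_restrict_mem hΩ.measurableSet] with x hx hxΩ
  have h0 := ha x hxΩ
  rw [hx, ENNReal.ofReal_add (by positivity) (by positivity), ENNReal.ofReal_mul h0,
    ← ENNReal.ofReal_rpow_of_nonneg (norm_nonneg _) hp,
    ← ENNReal.ofReal_rpow_of_nonneg (norm_nonneg _) hq, ofReal_norm]

theorem rpow_enorm_add_le {E : Type*} [NormedAddCommGroup E] (x y : E) {w₁ w₂ : ℝ≥0∞}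
    (h1 : w₁ ≠ 0) (h2 : w₂ ≠ 0) (hw : w₁ + w₂ = 1) {r q : ℝ} (hr : 1 ≤ r) (hrq : r ≤ q) :
    ‖x + y‖ₑ ^ r ≤ w₁ ^ (1 - q) * ‖x‖ₑ ^ r + w₂ ^ (1 - q) * ‖y‖ₑ ^ r := by
  have hr0 : 0 ≤ r := by linarith
  have aux : ∀ w : ℝ≥0∞, w ≠ 0 → w ≤ 1 → ∀ z : ℝ≥0∞,
      w * (z / w) ^ r ≤ w ^ (1 - q) * z ^ r := by
    intro w hw0 hw1 z
    have hwt : w ≠ ⊤ := ne_top_of_le_ne_top ENNReal.one_ne_top hw1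
    rw [ENNReal.div_rpow_of_nonneg _ _ hr0, div_eq_mul_inv, ← ENNReal.rpow_neg,
      mul_comm (z ^ r), ← mul_assoc]
    gcongr
    nth_rewrite 1 [← ENNReal.rpow_one w]
    rw [← ENNReal.rpow_add _ _ hw0 hwt]
    exact ENNReal.rpow_le_rpow_of_exponent_ge hw1 (by linarith)
  have l1 : w₁ ≤ 1 := hw ▸ le_self_add
  have l2 : w₂ ≤ 1 := hw ▸ le_add_self
  have ht1 : w₁ ≠ ⊤ := ne_top_of_le_ne_top ENNReal.one_ne_top l1
  have ht2 : w₂ ≠ ⊤ := ne_top_of_le_ne_top ENNReal.one_ne_top l2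
  calc ‖x + y‖ₑ ^ r ≤ (w₁ * (‖x‖ₑ / w₁) + w₂ * (‖y‖ₑ / w₂)) ^ r := by
        rw [ENNReal.mul_div_cancel h1 ht1, ENNReal.mul_div_cancel h2 ht2]
        gcongr
        exact enorm_add_le x y
    _ ≤ w₁ * (‖x‖ₑ / w₁) ^ r + w₂ * (‖y‖ₑ / w₂) ^ r :=
        ENNReal.rpow_arith_mean_le_arith_mean2_rpow _ _ _ _ hw hr
    _ ≤ _ := add_le_add (aux _ h1 l1 _) (aux _ h2 l2 _)

theorem AEMeasurable.dpEnergy_integrand {N : ℕ} {Ω : Set (Eucl N)} {a : Eucl N → ℝ} (p q : ℝ)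
    (ha : AEMeasurable a (volume.restrict Ω)) {G : Eucl N → Eucl N}
    (hG : AEStronglyMeasurable G (volume.restrict Ω)) :
    AEMeasurable (fun x => ‖G x‖ₑ ^ p + ENNReal.ofReal (a x) * ‖G x‖ₑ ^ q)
      (volume.restrict Ω) :=
  (hG.enorm.pow_const _).add (ha.ennreal_ofReal.mul (hG.enorm.pow_const _))

theorem tendsto_dpIntegrand_zero {E : Type*} [NormedAddCommGroup E] {p q : ℝ} (hp : 0 < p)
    (hq : 0 < q) (a : ℝ) {X : ℕ → E} (h : Filter.Tendsto X Filter.atTop (nhds 0)) :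
    Filter.Tendsto (fun n => ‖X n‖ₑ ^ p + ENNReal.ofReal a * ‖X n‖ₑ ^ q) Filter.atTop
      (nhds 0) := by
  have h2 : Filter.Tendsto (fun n => ‖X n‖ₑ) Filter.atTop (nhds 0) := by simpa using h.enorm
  have h3 := (ENNReal.continuous_rpow_const (y := p)).tendsto 0 |>.comp h2
  have h4 := (ENNReal.continuous_rpow_const (y := q)).tendsto 0 |>.comp h2
  rw [ENNReal.zero_rpow_of_pos hp] at h3
  rw [ENNReal.zero_rpow_of_pos hq] at h4
  have h5 := h3.add (ENNReal.Tendsto.const_mul (a := ENNReal.ofReal a) h4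
    (Or.inr ENNReal.ofReal_ne_top))
  simpa using h5

/-- Convexity of the energy, in the form of a weighted triangle inequality. -/
theorem dpEnergy_add_le {N : ℕ} {Ω : Set (Eucl N)} {a : Eucl N → ℝ} {p q : ℝ}
    (hp : 1 ≤ p) (hpq : p ≤ q) (ha : AEMeasurable a (volume.restrict Ω))
    {G H : Eucl N → Eucl N} (hG : AEStronglyMeasurable G (volume.restrict Ω))
    {w₁ w₂ : ℝ≥0∞} (h1 : w₁ ≠ 0) (h2 : w₂ ≠ 0) (hw : w₁ + w₂ = 1) :
    dpEnergy Ω a p q (G + H) ≤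
      w₁ ^ (1 - q) * dpEnergy Ω a p q G + w₂ ^ (1 - q) * dpEnergy Ω a p q H := by
  have l1 : w₁ ≤ 1 := hw ▸ le_self_add
  have l2 : w₂ ≤ 1 := hw ▸ le_add_self
  have ht1 : w₁ ≠ ⊤ := ne_top_of_le_ne_top ENNReal.one_ne_top l1
  have ht2 : w₂ ≠ ⊤ := ne_top_of_le_ne_top ENNReal.one_ne_top l2
  unfold dpEnergy
  rw [← lintegral_const_mul' _ _ (ENNReal.rpow_ne_top_of_ne_zero h1 ht1),
    ← lintegral_const_mul' _ _ (ENNReal.rpow_ne_top_of_ne_zero h2 ht2),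
    ← lintegral_add_left' ((AEMeasurable.dpEnergy_integrand p q ha hG).const_mul _)]
  refine lintegral_mono fun x => ?_
  have e1 := rpow_enorm_add_le (G x) (H x) h1 h2 hw hp hpq
  have e2 := rpow_enorm_add_le (G x) (H x) h1 h2 hw (hp.trans hpq) le_rfl
  calc ‖G x + H x‖ₑ ^ p + ENNReal.ofReal (a x) * ‖G x + H x‖ₑ ^ q
      ≤ (w₁ ^ (1 - q) * ‖G x‖ₑ ^ p + w₂ ^ (1 - q) * ‖H x‖ₑ ^ p) + ENNReal.ofReal (a x) *
        (w₁ ^ (1 - q) * ‖G x‖ₑ ^ q + w₂ ^ (1 - q) * ‖H x‖ₑ ^ q) := by gcongr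
    _ = _ := by ring

/-- The energy is quasi-subadditive. -/
theorem dpEnergy_add_le_two_mul {N : ℕ} {Ω : Set (Eucl N)} {a : Eucl N → ℝ} {p q : ℝ}
    (hp : 1 ≤ p) (hpq : p ≤ q) (ha : AEMeasurable a (volume.restrict Ω))
    {G H : Eucl N → Eucl N} (hG : AEStronglyMeasurable G (volume.restrict Ω)) :
    dpEnergy Ω a p q (G + H) ≤
      (2⁻¹ : ℝ≥0∞) ^ (1 - q) * (dpEnergy Ω a p q G + dpEnergy Ω a p q H) := by
  rw [mul_add]
  exact dpEnergy_add_le hp hpq ha hG (by simp) (by simp) ENNReal.inv_two_add_inv_two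

theorem two_inv_rpow_ne_top (r : ℝ) : (2⁻¹ : ℝ≥0∞) ^ r ≠ ⊤ :=
  ENNReal.rpow_ne_top_of_ne_zero (by simp) (by simp)

/-! ### Approximation in energy by gradients of test functions -/

/-- `G` is a limit, in energy, of gradients of test functions on `Ω`. -/
def ApproxByTest {N : ℕ} (Ω : Set (Eucl N)) (a : Eucl N → ℝ) (p q : ℝ)
    (G : Eucl N → Eucl N) : Prop :=
  ∀ ε : ℝ≥0∞, 0 < ε → ∃ φ, IsTestFunction Ω φ ∧ dpEnergy Ω a p q (G - gradient φ) < ε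

theorem ApproxByTest.congr {N : ℕ} {Ω : Set (Eucl N)} {a : Eucl N → ℝ} {p q : ℝ}
    {G H : Eucl N → Eucl N} (h : ApproxByTest Ω a p q G) (hGH : G =ᵐ[volume.restrict Ω] H) :
    ApproxByTest Ω a p q H := by
  intro ε hε
  obtain ⟨φ, hφ, h⟩ := h ε hε
  refine ⟨φ, hφ, ?_⟩
  rwa [← dpEnergy_congr (hGH.sub (Filter.EventuallyEq.refl _ (gradient φ)))]

theorem exists_pos_mul_add_lt {K ε : ℝ≥0∞} (hK : K ≠ ⊤) (hε : 0 < ε) :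
    ∃ η : ℝ≥0∞, 0 < η ∧ ∀ x y, x < η → y < η → K * (x + y) < ε := by
  obtain ⟨ε', hε', hε'ε⟩ := exists_between hε
  refine ⟨ε' / (K + 1) / 2, ?_, fun x y hx hy => ?_⟩
  · have : K + 1 ≠ ⊤ := by simp [hK]
    simp [ENNReal.div_pos_iff, hε'.ne', this]
  · calc K * (x + y) ≤ (K + 1) * (ε' / (K + 1) / 2 + ε' / (K + 1) / 2) := by
          gcongr
          exact le_self_add
      _ = (K + 1) * (ε' / (K + 1)) := by rw [ENNReal.add_halves]
      _ ≤ ε' := ENNReal.mul_div_le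
      _ < ε := hε'ε

theorem ApproxByTest.add {N : ℕ} {Ω : Set (Eucl N)} {a : Eucl N → ℝ} {p q : ℝ}
    (hp : 1 ≤ p) (hpq : p ≤ q) (ha : AEMeasurable a (volume.restrict Ω))
    {G H : Eucl N → Eucl N} (hG : AEStronglyMeasurable G (volume.restrict Ω))
    (h : ApproxByTest Ω a p q G) (h' : ApproxByTest Ω a p q H) :
    ApproxByTest Ω a p q (G + H) := by
  intro ε hε
  obtain ⟨η, hη, hlt⟩ := exists_pos_mul_add_lt (two_inv_rpow_ne_top (1 - q)) hε
  obtain ⟨φ, hφ, h1⟩ := h η hη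
  obtain ⟨ψ, hψ, h2⟩ := h' η hη
  refine ⟨φ + ψ, hφ.add hψ, ?_⟩
  have e : G + H - gradient (φ + ψ) = (G - gradient φ) + (H - gradient ψ) := by
    have : gradient (φ + ψ) = gradient φ + gradient ψ := by
      ext x i
      rw [Pi.add_apply, PiLp.add_apply]
      simp only [gradient_apply_eq_fderiv]
      rw [fderiv_add (hφ.contDiff_one.differentiable one_ne_zero x)
        (hψ.contDiff_one.differentiable one_ne_zero x)]
      rfl
    rw [this]
    abel
  rw [e]
  exact (dpEnergy_add_le_two_mul hp hpq ha
    (hG.sub hφ.contDiff_one.continuous_gradient.aestronglyMeasurable)).trans_lt (hlt _ _ h1 h2)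

theorem ApproxByTest.zero {N : ℕ} {Ω : Set (Eucl N)} {a : Eucl N → ℝ} {p q : ℝ}
    (hp : 0 < p) (hq : 0 < q) : ApproxByTest Ω a p q 0 := by
  intro ε hε
  refine ⟨0, IsTestFunction.zero, ?_⟩
  have : gradient (0 : Eucl N → ℝ) = 0 := by
    ext x i
    rw [gradient_apply_eq_fderiv]
    simp
  simp [this, dpEnergy, hp, hq, hε]

theorem ApproxByTest.sum {N : ℕ} {Ω : Set (Eucl N)} {a : Eucl N → ℝ} {p q : ℝ}
    (hp : 1 ≤ p) (hpq : p ≤ q) (ha : AEMeasurable a (volume.restrict Ω)) {ι : Type*}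
    (s : Finset ι) {G : ι → Eucl N → Eucl N}
    (hG : ∀ i, AEStronglyMeasurable (G i) (volume.restrict Ω))
    (h : ∀ i, ApproxByTest Ω a p q (G i)) :
    ApproxByTest Ω a p q (∑ i ∈ s, G i) := by
  classical
  induction s using Finset.induction_on with
  | empty => simpa using ApproxByTest.zero (by linarith) (by linarith)
  | insert i s his ih =>
    rw [Finset.sum_insert his]
    exact (h i).add hp hpq ha (hG i) ih

/-- The vector fields that can be approximated are closed in energy. -/
theorem ApproxByTest.of_forall_exists {N : ℕ} {Ω : Set (Eucl N)} {a : Eucl N → ℝ} {p q : ℝ}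
    (hp : 1 ≤ p) (hpq : p ≤ q) (ha : AEMeasurable a (volume.restrict Ω))
    {G : Eucl N → Eucl N} (hG : AEStronglyMeasurable G (volume.restrict Ω))
    (h : ∀ ε : ℝ≥0∞, 0 < ε → ∃ H, AEStronglyMeasurable H (volume.restrict Ω) ∧
      ApproxByTest Ω a p q H ∧ dpEnergy Ω a p q (G - H) < ε) :
    ApproxByTest Ω a p q G := by
  intro ε hε
  obtain ⟨η, hη, hlt⟩ := exists_pos_mul_add_lt (two_inv_rpow_ne_top (1 - q)) hε
  obtain ⟨H, hH, hA, h1⟩ := h η hη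
  obtain ⟨φ, hφ, h2⟩ := hA η hη
  refine ⟨φ, hφ, ?_⟩
  have e : G - gradient φ = (G - H) + (H - gradient φ) := by abel
  rw [e]
  exact (dpEnergy_add_le_two_mul hp hpq ha (hG.sub hH)).trans_lt (hlt _ _ h1 h2)

theorem IsTestFunction.memW11Zero {N : ℕ} {Ω : Set (Eucl N)} (hΩ : IsOpen Ω) {φ : Eucl N → ℝ}
    (h : IsTestFunction Ω φ) : MemW11Zero Ω φ := by
  refine ⟨⟨?_, gradient φ, h.contDiff_one.isWeakGradient Ω, ?_⟩, fun ε hε => ⟨φ, h, ?_⟩⟩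
  · exact (h.1.continuous.integrable_of_hasCompactSupport h.2.1).integrableOn
  · refine (h.contDiff_one.continuous_gradient.integrable_of_hasCompactSupport ?_).integrableOn
    exact (h.2.1.fderiv (𝕜 := ℝ)).comp_left (map_zero _)
  · have h0 : IsWeakGradient Ω (φ - φ) (gradient φ - gradient φ) :=
      (h.contDiff_one.isWeakGradient Ω).sub (h.contDiff_one.isWeakGradient Ω)
    have e := weakGradient_ae_eq hΩ h0
    have e2 : ∫⁻ x in Ω, ‖weakGradient Ω (φ - φ) x‖ₑ = 0 := by
      rw [lintegral_eq_zero_iff' (by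
        exact (aestronglyMeasurable_const (b := (0 : Eucl N))).enorm.congr
          (by filter_upwards [e] with x hx; rw [hx]; simp))]
      filter_upwards [e] with x hx
      rw [hx]
      simp
    rw [normW11, e2]
    simpa using hε

/-- If the weak gradients of all `v ∈ W^{1,1}_0(Ω)` of finite energy can be approximated in energy
by gradients of test functions, then the two infima agree; this uses the convexity of the energy
around `u₀ + v`. -/
theorem iInf_doublePhase_eq_of_approxByTest {N : ℕ} {Ω : Set (Eucl N)} (hΩ : IsOpen Ω)
    {a : Eucl N → ℝ} {p q : ℝ} (hp : 1 ≤ p) (hpq : p ≤ q)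
    (ha : AEMeasurable a (volume.restrict Ω)) (ha0 : ∀ x ∈ Ω, 0 ≤ a x)
    (h : ∀ v G, MemW11Zero Ω v → IsWeakGradient Ω v G → IntegrableOn G Ω →
      dpEnergy Ω a p q G < ∞ → ApproxByTest Ω a p q G)
    {u₀ : Eucl N → ℝ} (hu₀ : MemW11 Ω u₀) (hfin : doublePhase Ω a p q u₀ < ∞) :
    (⨅ v ∈ {v : Eucl N → ℝ | MemW11Zero Ω v}, doublePhase Ω a p q (u₀ + v)) =
      ⨅ φ ∈ {φ : Eucl N → ℝ | IsTestFunction Ω φ}, doublePhase Ω a p q (u₀ + φ) := by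
  have hp0 : 0 ≤ p := by linarith
  have hq0 : 0 ≤ q := by linarith
  refine le_antisymm ?_ ?_
  · refine le_iInf₂ fun φ hφ => iInf₂_le φ (IsTestFunction.memW11Zero hΩ hφ)
  refine le_iInf₂ fun v hv => ?_
  rcases eq_or_ne (doublePhase Ω a p q (u₀ + v)) ∞ with htop | htop
  · rw [htop]; exact le_top
  obtain ⟨-, G₀, hG₀, hG₀i⟩ := hu₀
  have hv' : MemW11Zero Ω v := hv
  obtain ⟨⟨-, G, hG, hGi⟩, -⟩ := hv'
  rw [doublePhase_eq_dpEnergy hΩ hp0 hq0 ha0 hG₀] at hfin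
  have eS := doublePhase_eq_dpEnergy hΩ hp0 hq0 ha0 (hG₀.add hG)
  rw [eS] at htop ⊢
  have hGfin : dpEnergy Ω a p q G < ∞ := by
    have e : G = (G₀ + G) + -G₀ := by abel
    rw [e]
    refine (dpEnergy_add_le_two_mul hp hpq ha
      (hG₀i.aestronglyMeasurable.add hGi.aestronglyMeasurable)).trans_lt ?_
    rw [dpEnergy_neg]
    exact ENNReal.mul_lt_top (two_inv_rpow_ne_top _).lt_top
      (ENNReal.add_lt_top.2 ⟨htop.lt_top, hfin⟩)
  have hA := h v G hv hG hGi hGfin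
  set I := ⨅ φ ∈ {φ : Eucl N → ℝ | IsTestFunction Ω φ}, doublePhase Ω a p q (u₀ + φ)
  -- `u₀ + φ = (u₀ + v) + (φ - v)`, and the second summand has energy as small as desired
  have step : ∀ w₁ w₂ : ℝ≥0∞, w₁ ≠ 0 → w₂ ≠ 0 → w₁ + w₂ = 1 →
      I ≤ w₁ ^ (1 - q) * dpEnergy Ω a p q (G₀ + G) := by
    intro w₁ w₂ h1 h2 hw
    have l2 : w₂ ≤ 1 := hw ▸ le_add_self
    have ht2 : w₂ ^ (1 - q) ≠ ⊤ :=
      ENNReal.rpow_ne_top_of_ne_zero h2 (ne_top_of_le_ne_top ENNReal.one_ne_top l2)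
    refine ENNReal.le_of_forall_pos_le_add fun ε hε _ => ?_
    obtain ⟨η, hη, hlt⟩ := exists_pos_mul_add_lt ht2 (ε := (ε : ℝ≥0∞)) (by exact_mod_cast hε)
    obtain ⟨φ, hφ, h3⟩ := hA η hη
    have hI : I ≤ doublePhase Ω a p q (u₀ + φ) := iInf₂_le φ hφ
    refine hI.trans ?_
    rw [doublePhase_eq_dpEnergy hΩ hp0 hq0 ha0 (hG₀.add (hφ.contDiff_one.isWeakGradient Ω))]
    have e : G₀ + gradient φ = (G₀ + G) + -(G - gradient φ) := by abel
    rw [e]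
    refine (dpEnergy_add_le hp hpq ha
      (hG₀i.aestronglyMeasurable.add hGi.aestronglyMeasurable) h1 h2 hw).trans ?_
    rw [dpEnergy_neg]
    gcongr
    have := hlt _ 0 h3 hη
    rw [add_zero] at this
    exact this.le
  have hlim : Filter.Tendsto (fun n : ℕ => ((1 : ℝ≥0∞) - ((n : ℝ≥0∞) + 2)⁻¹) ^ (1 - q) *
      dpEnergy Ω a p q (G₀ + G)) Filter.atTop (nhds (dpEnergy Ω a p q (G₀ + G))) := by
    have t1 : Filter.Tendsto (fun n : ℕ => ((n : ℝ≥0∞) + 2)⁻¹) Filter.atTop (nhds 0) := by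
      have := (Filter.tendsto_add_atTop_iff_nat 2).2 ENNReal.tendsto_inv_nat_nhds_zero
      simpa using this
    have t2 := ENNReal.Tendsto.sub (tendsto_const_nhds (x := (1 : ℝ≥0∞))) t1
      (Or.inl ENNReal.one_ne_top)
    have t3 := (ENNReal.continuous_rpow_const (y := 1 - q)).tendsto (1 - 0 : ℝ≥0∞)
    have t4 := t3.comp t2
    have t5 := ENNReal.Tendsto.mul_const (b := dpEnergy Ω a p q (G₀ + G)) t4 (Or.inr htop)
    simpa using t5
  refine ge_of_tendsto' hlim fun n => ?_
  refine step _ ((n : ℝ≥0∞) + 2)⁻¹ ?_ ?_ ?_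
  · have : ((n : ℝ≥0∞) + 2)⁻¹ < 1 := by
      rw [ENNReal.inv_lt_one]
      exact lt_of_lt_of_le ENNReal.one_lt_two le_add_self
    exact (tsub_pos_of_lt this).ne'
  · simp
  · refine tsub_add_cancel_of_le ?_
    rw [ENNReal.inv_le_one]
    exact le_trans ENNReal.one_lt_two.le le_add_self

/-! ### Zero extension and truncation of functions in `W^{1,1}_0` -/

theorem enorm_euclidean_apply_le {N : ℕ} (x : Eucl N) (i : Fin N) : ‖x i‖ₑ ≤ ‖x‖ₑ := by
  rw [← ofReal_norm, ← ofReal_norm]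
  exact ENNReal.ofReal_le_ofReal (PiLp.norm_apply_le x i)

theorem lintegral_enorm_sub_comm {α E : Type*} [MeasurableSpace α] [NormedAddCommGroup E]
    (μ : Measure α) (f g : α → E) : ∫⁻ x, ‖f x - g x‖ₑ ∂μ = ∫⁻ x, ‖g x - f x‖ₑ ∂μ := by
  simp_rw [← enorm_neg (f _ - g _), neg_sub]

/-- A function in `W^{1,1}_0(Ω)` is the limit of test functions in `W^{1,1}(Ω)` and almost
everywhere. -/
theorem MemW11Zero.exists_seq {N : ℕ} {Ω : Set (Eucl N)} (hΩ : IsOpen Ω) {v : Eucl N → ℝ}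
    {G : Eucl N → Eucl N} (hv : MemW11Zero Ω v) (hG : IsWeakGradient Ω v G) :
    ∃ φ : ℕ → Eucl N → ℝ, (∀ n, IsTestFunction Ω (φ n)) ∧
      Filter.Tendsto (fun n => ∫⁻ x in Ω, ‖φ n x - v x‖ₑ) Filter.atTop (nhds 0) ∧
      Filter.Tendsto (fun n => ∫⁻ x in Ω, ‖gradient (φ n) x - G x‖ₑ) Filter.atTop (nhds 0) ∧
      ∀ᵐ x ∂volume.restrict Ω, Filter.Tendsto (fun n => φ n x) Filter.atTop (nhds (v x)) := by
  have hex : ∀ n : ℕ, ∃ φ, IsTestFunction Ω φ ∧ normW11 Ω (v - φ) < ((n : ℝ≥0∞) + 1)⁻¹ :=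
    fun n => hv.2 _ (by simp)
  choose φ hφ hlt using hex
  have hlim : Filter.Tendsto (fun n : ℕ => ((n : ℝ≥0∞) + 1)⁻¹) Filter.atTop (nhds 0) := by
    have := (Filter.tendsto_add_atTop_iff_nat 1).2 ENNReal.tendsto_inv_nat_nhds_zero
    simpa using this
  have e1 : ∀ n, ∫⁻ x in Ω, ‖φ n x - v x‖ₑ ≤ ((n : ℝ≥0∞) + 1)⁻¹ := fun n => by
    rw [lintegral_enorm_sub_comm]
    exact le_self_add.trans (hlt n).le
  have e2 : ∀ n, ∫⁻ x in Ω, ‖gradient (φ n) x - G x‖ₑ ≤ ((n : ℝ≥0∞) + 1)⁻¹ := fun n => by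
    rw [lintegral_enorm_sub_comm]
    refine le_trans (le_of_eq ?_) (le_add_self.trans (hlt n).le)
    refine lintegral_congr_ae ?_
    filter_upwards [weakGradient_ae_eq hΩ (hG.sub ((hφ n).contDiff_one.isWeakGradient Ω))] with x hx
    rw [hx]
    rfl
  have t1 := tendsto_of_tendsto_of_tendsto_of_le_of_le tendsto_const_nhds hlim
    (fun n => zero_le) e1
  have t2 := tendsto_of_tendsto_of_tendsto_of_le_of_le tendsto_const_nhds hlim
    (fun n => zero_le) e2
  have hm : TendstoInMeasure (volume.restrict Ω) φ Filter.atTop v := by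
    refine tendstoInMeasure_of_tendsto_eLpNorm (p := 1) one_ne_zero
      (fun n => (hφ n).1.continuous.aestronglyMeasurable) hv.1.1.aestronglyMeasurable ?_
    simpa only [eLpNorm_one_eq_lintegral_enorm, Pi.sub_apply] using t1
  obtain ⟨ns, hns, hae⟩ := hm.exists_seq_tendsto_ae
  exact ⟨fun n => φ (ns n), fun n => hφ _, t1.comp hns.tendsto_atTop, t2.comp hns.tendsto_atTop,
    hae⟩

theorem abs_sub_le_of_abs_deriv_le_one {τ : ℝ → ℝ} (hτ : ContDiff ℝ 1 τ)
    (hd : ∀ s, |deriv τ s| ≤ 1) (s t : ℝ) : |τ s - τ t| ≤ |s - t| := by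
  have h := Convex.norm_image_sub_le_of_norm_deriv_le (f := τ) (s := univ) (C := 1) (x := t)
    (y := s) (fun x _ => hτ.differentiable one_ne_zero x) (fun x _ => hd x) convex_univ
    (mem_univ _) (mem_univ _)
  simpa using h

/-- Chain rule and zero extension: if `v ∈ W^{1,1}_0(Ω)` and `τ` is `C^1` with `τ 0 = 0` and
`|τ'| ≤ 1`, then `τ ∘ v`, extended by zero, has the weak gradient `τ'(v) ∇v`, extended by zero, on
the whole space. -/
theorem MemW11Zero.isWeakGradient_indicator_comp {N : ℕ} {Ω : Set (Eucl N)} (hΩ : IsOpen Ω)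
    {v : Eucl N → ℝ} {G : Eucl N → Eucl N} (hv : MemW11Zero Ω v) (hG : IsWeakGradient Ω v G)
    (hGi : IntegrableOn G Ω) {τ : ℝ → ℝ} (hτ : ContDiff ℝ 1 τ) (hτ0 : τ 0 = 0)
    (hd : ∀ s, |deriv τ s| ≤ 1) :
    IsWeakGradient univ (Ω.indicator fun x => τ (v x))
      (Ω.indicator fun x => deriv τ (v x) • G x) := by
  have hvi : IntegrableOn v Ω := hv.1.1
  have hdc : Continuous (deriv τ) := hτ.continuous_deriv le_rfl
  have i1 : IntegrableOn (fun x => τ (v x)) Ω := by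
    refine Integrable.mono hvi (hτ.continuous.comp_aestronglyMeasurable hvi.aestronglyMeasurable)
      (Filter.Eventually.of_forall fun x => ?_)
    simpa [hτ0] using abs_sub_le_of_abs_deriv_le_one hτ hd (v x) 0
  have i2 : IntegrableOn (fun x => deriv τ (v x) • G x) Ω := by
    refine Integrable.mono hGi ((hdc.comp_aestronglyMeasurable hvi.aestronglyMeasurable).smul
      hGi.aestronglyMeasurable) (Filter.Eventually.of_forall fun x => ?_)
    rw [norm_smul]
    exact mul_le_of_le_one_left (norm_nonneg _) (hd _)
  refine ⟨(i1.integrable_indicator hΩ.measurableSet).locallyIntegrable.locallyIntegrableOn _,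
    (i2.integrable_indicator hΩ.measurableSet).locallyIntegrable.locallyIntegrableOn _,
    fun ψ hψ i => ?_⟩
  obtain ⟨φ, hφ, t1, t2, hae⟩ := hv.exists_seq hΩ hG
  set e : Eucl N := EuclideanSpace.single i 1 with he
  have cψ := hψ.continuous_fderiv_apply e
  obtain ⟨K, hK⟩ := hψ.1.continuous.bounded_above_of_compact_support hψ.2.1
  obtain ⟨K', hK'⟩ := cψ.bounded_above_of_compact_support (hψ.hasCompactSupport_fderiv_apply e)
  have cGi : AEStronglyMeasurable (fun x => G x i) (volume.restrict Ω) :=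
    ((EuclideanSpace.proj i : Eucl N →L[ℝ] ℝ).integrable_comp hGi).aestronglyMeasurable
  -- integration by parts for the approximating test functions
  have hn : ∀ n, ∫ x in Ω, τ (φ n x) * fderiv ℝ ψ x e =
      -∫ x in Ω, ψ x * (deriv τ (φ n x) * gradient (φ n) x i) := by
    intro n
    have h := integral_mul_fderiv_eq_neg (hτ.comp (hφ n).contDiff_one) hψ.contDiff_one hψ.2.1 e
    have hfd : ∀ x, fderiv ℝ (τ ∘ φ n) x e = deriv τ (φ n x) * gradient (φ n) x i := by
      intro x
      rw [fderiv_comp x (hτ.differentiable one_ne_zero _)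
        ((hφ n).contDiff_one.differentiable one_ne_zero x), gradient_apply_eq_fderiv]
      simp only [ContinuousLinearMap.comp_apply]
      rw [← he, fderiv_eq_smul_deriv, smul_eq_mul, mul_comm]
    simp only [hfd, Function.comp_apply] at h
    rw [setIntegral_eq_integral_of_forall_compl_eq_zero,
      setIntegral_eq_integral_of_forall_compl_eq_zero, h]
    · intro x hx
      rw [gradient_apply_eq_fderiv,
        fderiv_apply_eq_zero_of_notMem_tsupport fun h => hx ((hφ n).2.2 h), mul_zero, mul_zero]
    · intro x hx
      rw [image_eq_zero_of_notMem_tsupport fun h => hx ((hφ n).2.2 h), hτ0, zero_mul]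
  have j1 : ∀ f : Eucl N → ℝ, IntegrableOn f Ω →
      Integrable (fun x => f x * fderiv ℝ ψ x e) (volume.restrict Ω) := fun f hf =>
    Integrable.mul_bdd (c := K') hf cψ.aestronglyMeasurable (Filter.Eventually.of_forall hK')
  have j2 : ∀ f : Eucl N → ℝ, IntegrableOn f Ω →
      Integrable (fun x => ψ x * f x) (volume.restrict Ω) := fun f hf =>
    Integrable.bdd_mul (c := K) hf hψ.1.continuous.aestronglyMeasurable
      (Filter.Eventually.of_forall hK)
  have iφ : ∀ n, IntegrableOn (fun x => τ (φ n x)) Ω := fun n => by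
    refine Integrable.mono (((hφ n).memW11Zero hΩ).1.1)
      (hτ.continuous.comp (hφ n).1.continuous).aestronglyMeasurable
      (Filter.Eventually.of_forall fun x => ?_)
    simpa [hτ0] using abs_sub_le_of_abs_deriv_le_one hτ hd (φ n x) 0
  have iφ' : ∀ n, IntegrableOn (fun x => deriv τ (φ n x) * gradient (φ n) x i) Ω := fun n => by
    refine (Continuous.integrable_of_hasCompactSupport ?_ ?_).integrableOn
    · refine (hdc.comp (hφ n).1.continuous).mul ?_
      simpa only [gradient_apply_eq_fderiv] using (hφ n).continuous_fderiv_apply _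
    · refine HasCompactSupport.mul_left ?_
      simpa only [gradient_apply_eq_fderiv] using (hφ n).hasCompactSupport_fderiv_apply _
  have iG' : IntegrableOn (fun x => deriv τ (v x) * G x i) Ω := by
    exact (EuclideanSpace.proj i : Eucl N →L[ℝ] ℝ).integrable_comp i2
  have L1 : Filter.Tendsto (fun n => ∫ x in Ω, τ (φ n x) * fderiv ℝ ψ x e) Filter.atTop
      (nhds (∫ x in Ω, τ (v x) * fderiv ℝ ψ x e)) := by
    refine tendsto_integral_of_L1 _ (j1 _ i1).aestronglyMeasurable
      (Filter.Eventually.of_forall fun n => j1 _ (iφ n)) ?_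
    have t3 := ENNReal.Tendsto.const_mul (a := ENNReal.ofReal K') t1 (Or.inr ENNReal.ofReal_ne_top)
    rw [mul_zero] at t3
    refine tendsto_of_tendsto_of_tendsto_of_le_of_le tendsto_const_nhds t3
      (fun n => zero_le) fun n => ?_
    change _ ≤ ENNReal.ofReal K' * _
    rw [← lintegral_const_mul' _ _ ENNReal.ofReal_ne_top]
    refine lintegral_mono fun x => ?_
    rw [← sub_mul, enorm_mul, mul_comm]
    gcongr
    · rw [← ofReal_norm]
      exact ENNReal.ofReal_le_ofReal (hK' x)
    · rw [← ofReal_norm, ← ofReal_norm]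
      exact ENNReal.ofReal_le_ofReal (abs_sub_le_of_abs_deriv_le_one hτ hd _ _)
  have L2 : Filter.Tendsto (fun n => ∫ x in Ω, ψ x * (deriv τ (φ n x) * gradient (φ n) x i))
      Filter.atTop (nhds (∫ x in Ω, ψ x * (deriv τ (v x) * G x i))) := by
    refine tendsto_integral_of_L1 _ (j2 _ iG').aestronglyMeasurable
      (Filter.Eventually.of_forall fun n => j2 _ (iφ' n)) ?_
    have t3 := ENNReal.Tendsto.const_mul (a := ENNReal.ofReal K) t2 (Or.inr ENNReal.ofReal_ne_top)
    -- `τ'(φ n) ∇(φ n) - τ'(v) G = τ'(φ n) (∇(φ n) - G) + (τ'(φ n) - τ'(v)) G`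
    have t4 : Filter.Tendsto (fun n => ∫⁻ x in Ω,
        ENNReal.ofReal K * ‖(deriv τ (φ n x) - deriv τ (v x)) * G x i‖ₑ) Filter.atTop
        (nhds (∫⁻ x in Ω, 0)) := by
      refine tendsto_lintegral_of_dominated_convergence'
        (fun x => ENNReal.ofReal K * (2 * ‖G x‖ₑ)) (fun n => ?_) (fun n => ?_) ?_ ?_
      · exact ((((hdc.comp (hφ n).1.continuous).aestronglyMeasurable.sub
          (hdc.comp_aestronglyMeasurable hvi.aestronglyMeasurable)).mul cGi).enorm).const_mul _
      · refine Filter.Eventually.of_forall fun x => ?_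
        dsimp only
        gcongr
        rw [enorm_mul]
        gcongr
        · refine (enorm_sub_le).trans ?_
          rw [← one_add_one_eq_two, ← ofReal_norm, ← ofReal_norm]
          exact add_le_add (ENNReal.ofReal_le_one.2 (hd _)) (ENNReal.ofReal_le_one.2 (hd _))
        · exact enorm_euclidean_apply_le _ _
      · rw [lintegral_const_mul' _ _ ENNReal.ofReal_ne_top,
          lintegral_const_mul' _ _ ENNReal.ofNat_ne_top]
        exact ENNReal.mul_ne_top ENNReal.ofReal_ne_top
          (ENNReal.mul_ne_top ENNReal.ofNat_ne_top hGi.2.ne)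
      · filter_upwards [hae] with x hx
        have h1 : Filter.Tendsto (fun n => (deriv τ (φ n x) - deriv τ (v x)) * G x i)
            Filter.atTop (nhds ((deriv τ (v x) - deriv τ (v x)) * G x i)) :=
          (((hdc.tendsto _).comp hx).sub_const _).mul_const _
        have h2 := ENNReal.Tendsto.const_mul (a := ENNReal.ofReal K) h1.enorm
          (Or.inr ENNReal.ofReal_ne_top)
        simpa using h2
    have t5 := t3.add t4
    simp only [mul_zero, lintegral_zero, add_zero] at t5
    refine tendsto_of_tendsto_of_tendsto_of_le_of_le tendsto_const_nhds t5
      (fun n => zero_le) fun n => ?_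
    change _ ≤ ENNReal.ofReal K * _ + _
    rw [← lintegral_const_mul' _ _ ENNReal.ofReal_ne_top,
      ← lintegral_add_left' (f := fun x => ENNReal.ofReal K * ‖gradient (φ n) x - G x‖ₑ)
        (((((hφ n).contDiff_one.continuous_gradient.aestronglyMeasurable).sub
          hGi.aestronglyMeasurable).enorm).const_mul _)]
    refine lintegral_mono fun x => ?_
    have e1 : ψ x * (deriv τ (φ n x) * gradient (φ n) x i) - ψ x * (deriv τ (v x) * G x i) =
        ψ x * (deriv τ (φ n x) * (gradient (φ n) x - G x) i) +
          ψ x * ((deriv τ (φ n x) - deriv τ (v x)) * G x i) := by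
      rw [PiLp.sub_apply]; ring
    rw [e1]
    refine (enorm_add_le _ _).trans ?_
    have hKx : ‖ψ x‖ₑ ≤ ENNReal.ofReal K := by
      rw [← ofReal_norm]
      exact ENNReal.ofReal_le_ofReal (hK x)
    rw [enorm_mul, enorm_mul (ψ x), enorm_mul (deriv τ (φ n x))]
    gcongr
    refine (mul_le_of_le_one_left' ?_).trans (enorm_euclidean_apply_le _ _)
    rw [← ofReal_norm]
    exact ENNReal.ofReal_le_one.2 (hd _)
  have key := tendsto_nhds_unique (L1.congr hn) L2.neg
  rw [setIntegral_univ, setIntegral_univ]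
  have r1 : ∫ x, Ω.indicator (fun x => τ (v x)) x * fderiv ℝ ψ x e =
      ∫ x in Ω, τ (v x) * fderiv ℝ ψ x e := by
    rw [← integral_indicator hΩ.measurableSet]
    congr 1 with x
    by_cases hx : x ∈ Ω <;> simp [hx]
  have r2 : ∫ x, ψ x * (Ω.indicator (fun x => deriv τ (v x) • G x) x) i =
      ∫ x in Ω, ψ x * (deriv τ (v x) * G x i) := by
    rw [← integral_indicator hΩ.measurableSet]
    congr 1 with x
    by_cases hx : x ∈ Ω <;> simp [hx]
  rw [r1, r2, key]

/-- The smooth truncation `s ↦ k arctan (s / k)`. -/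
noncomputable def arctanTrunc (k : ℝ) (s : ℝ) : ℝ := k * Real.arctan (s / k)

theorem contDiff_arctanTrunc (k : ℝ) : ContDiff ℝ 1 (arctanTrunc k) :=
  contDiff_const.mul (Real.contDiff_arctan.comp (contDiff_id.div_const k))

theorem deriv_arctanTrunc {k : ℝ} (hk : 0 < k) (s : ℝ) :
    deriv (arctanTrunc k) s = 1 / (1 + (s / k) ^ 2) := by
  have h := (((Real.hasDerivAt_arctan (s / k)).comp s ((hasDerivAt_id s).div_const k)).const_mul k)
  refine h.deriv.trans ?_
  field_simp

theorem abs_arctanTrunc_le {k : ℝ} (hk : 0 < k) (s : ℝ) : |arctanTrunc k s| ≤ k * 2 := by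
  rw [arctanTrunc, abs_mul, abs_of_pos hk]
  gcongr
  rw [abs_le]
  have h1 := Real.neg_pi_div_two_lt_arctan (s / k)
  have h2 := Real.arctan_lt_pi_div_two (s / k)
  have h3 := Real.pi_lt_four
  constructor <;> linarith

theorem deriv_arctanTrunc_mem {k : ℝ} (hk : 0 < k) (s : ℝ) :
    deriv (arctanTrunc k) s ∈ Icc (0 : ℝ) 1 := by
  rw [deriv_arctanTrunc hk]
  have h : 0 < 1 + (s / k) ^ 2 := by positivity
  refine ⟨by positivity, ?_⟩
  rw [div_le_one h]
  nlinarith [sq_nonneg (s / k)]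

/-- The truncations converge in energy. -/
theorem tendsto_dpEnergy_truncation {N : ℕ} {Ω : Set (Eucl N)} {a : Eucl N → ℝ} {p q : ℝ}
    (hp : 0 < p) (hq : 0 < q) (ha : AEMeasurable a (volume.restrict Ω)) {v : Eucl N → ℝ}
    {G : Eucl N → Eucl N} (hv : AEStronglyMeasurable v (volume.restrict Ω))
    (hG : AEStronglyMeasurable G (volume.restrict Ω)) (hfin : dpEnergy Ω a p q G < ∞) :
    Filter.Tendsto (fun k : ℕ => dpEnergy Ω a p q
      (G - fun x => deriv (arctanTrunc (k + 1)) (v x) • G x)) Filter.atTop (nhds 0) := by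
  have hz : (0 : ℝ≥0∞) = ∫⁻ x in Ω, 0 := by simp
  rw [hz]
  have hk : ∀ k : ℕ, (0 : ℝ) < k + 1 := fun k => by positivity
  have hle : ∀ (k : ℕ) x, ‖(G - fun x => deriv (arctanTrunc (k + 1)) (v x) • G x) x‖ₑ ≤
      ‖G x‖ₑ := by
    intro k x
    have h := deriv_arctanTrunc_mem (hk k) (v x)
    have e : (G - fun x => deriv (arctanTrunc (k + 1)) (v x) • G x) x =
        (1 - deriv (arctanTrunc (k + 1)) (v x)) • G x := by
      simp [sub_smul]
    rw [e, enorm_smul]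
    refine mul_le_of_le_one_left' ?_
    rw [← ofReal_norm, Real.norm_of_nonneg (by linarith [h.2])]
    exact ENNReal.ofReal_le_one.2 (by linarith [h.1])
  refine tendsto_lintegral_of_dominated_convergence'
    (fun x => ‖G x‖ₑ ^ p + ENNReal.ofReal (a x) * ‖G x‖ₑ ^ q) (fun k => ?_) (fun k => ?_) hfin.ne ?_
  · refine AEMeasurable.dpEnergy_integrand p q ha (hG.sub ?_)
    exact (((contDiff_arctanTrunc _).continuous_deriv le_rfl).comp_aestronglyMeasurable hv).smul hG
  · refine Filter.Eventually.of_forall fun x => ?_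
    have := hle k x
    dsimp only
    gcongr
  · refine Filter.Eventually.of_forall fun x => ?_
    have h1 : Filter.Tendsto (fun k : ℕ => G x - deriv (arctanTrunc (k + 1)) (v x) • G x)
        Filter.atTop (nhds 0) := by
      have t1 : Filter.Tendsto (fun k : ℕ => v x / ((k : ℝ) + 1)) Filter.atTop (nhds 0) :=
        tendsto_const_div_atTop_nhds_zero_nat (v x) |>.comp (Filter.tendsto_add_atTop_nat 1)
          |>.congr fun k => by simp
      have t2 : Filter.Tendsto (fun k : ℕ => 1 / (1 + (v x / ((k : ℝ) + 1)) ^ 2)) Filter.atTop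
          (nhds (1 / (1 + 0 ^ 2))) :=
        tendsto_const_nhds.div ((t1.pow 2).const_add 1) (by norm_num)
      have t3 := (tendsto_const_nhds (x := G x)).sub (t2.smul_const (G x))
      simp only [deriv_arctanTrunc (hk _)]
      simpa using t3
    exact tendsto_dpIntegrand_zero hp hq (a x) h1

theorem IsWeakGradient.smooth_mul {N : ℕ} {w θ : Eucl N → ℝ} {H : Eucl N → Eucl N}
    (h : IsWeakGradient univ w H) (hθ : ContDiff ℝ (⊤ : ℕ∞) θ) :
    IsWeakGradient univ (fun x => θ x * w x) (fun x => θ x • H x + w x • gradient θ x) := by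
  have hθ1 : ContDiff ℝ 1 θ := hθ.of_le (by exact_mod_cast le_top)
  have cg := hθ1.continuous_gradient
  have l1 : LocallyIntegrable w := locallyIntegrableOn_univ.1 h.1
  have l2 : LocallyIntegrable H := locallyIntegrableOn_univ.1 h.2.1
  have lHi : ∀ i, LocallyIntegrableOn (fun x => H x i) univ :=
    fun i => locallyIntegrableOn_euclidean_apply h.2.1 i
  have m1 : LocallyIntegrableOn (fun x => θ x * w x) univ :=
    h.1.continuousOn_smul isOpen_univ.isLocallyClosed hθ.continuous.continuousOn
  have m2 : LocallyIntegrableOn (fun x => θ x • H x) univ :=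
    h.2.1.continuousOn_smul isOpen_univ.isLocallyClosed hθ.continuous.continuousOn
  have m3 : LocallyIntegrableOn (fun x => w x • gradient θ x) univ :=
    h.1.smul_continuousOn isOpen_univ.isLocallyClosed cg.continuousOn
  refine ⟨m1, m2.add m3, fun ψ hψ i => ?_⟩
  set e : Eucl N := EuclideanSpace.single i 1 with he
  have hT : IsTestFunction univ (θ * ψ) := ⟨hθ.mul hψ.1, hψ.2.1.mul_left, subset_univ _⟩
  have hw := h.2.2 _ hT i
  have hfd : ∀ x, fderiv ℝ (θ * ψ) x e = θ x * fderiv ℝ ψ x e + ψ x * gradient θ x i := by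
    intro x
    rw [fderiv_mul (hθ1.differentiable one_ne_zero x)
      (hψ.contDiff_one.differentiable one_ne_zero x), gradient_apply_eq_fderiv]
    simp [he]
  simp only [setIntegral_univ] at hw ⊢
  simp only [← he, hfd, Pi.mul_apply] at hw
  have cgi : Continuous fun x => gradient θ x i :=
    (EuclideanSpace.proj i : Eucl N →L[ℝ] ℝ).continuous.comp cg
  have I1 : Integrable (fun x => w x * (θ x * fderiv ℝ ψ x e)) := by
    have := integrableOn_mul_of_hasCompactSupport h.1
      (hθ.continuous.mul (hψ.continuous_fderiv_apply e))
      (hψ.hasCompactSupport_fderiv_apply e).mul_left (subset_univ _)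
    rwa [Measure.restrict_univ] at this
  have I2 : Integrable (fun x => w x * (ψ x * gradient θ x i)) := by
    have := integrableOn_mul_of_hasCompactSupport h.1 (hψ.1.continuous.mul cgi)
      hψ.2.1.mul_right (subset_univ _)
    rwa [Measure.restrict_univ] at this
  have I3 : Integrable (fun x => H x i * (θ x * ψ x)) := by
    have := integrableOn_mul_of_hasCompactSupport (lHi i) (hθ.continuous.mul hψ.1.continuous)
      hψ.2.1.mul_left (subset_univ _)
    rwa [Measure.restrict_univ] at this
  simp only [mul_add] at hw
  rw [integral_add I1 I2] at hw
  have g1 : ∫ x, θ x * w x * fderiv ℝ ψ x e = ∫ x, w x * (θ x * fderiv ℝ ψ x e) := by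
    congr 1 with x; ring
  have g2 : ∫ x, ψ x * (θ x • H x + w x • gradient θ x) i =
      (∫ x, θ x * ψ x * H x i) + ∫ x, w x * (ψ x * gradient θ x i) := by
    rw [← integral_add (by simpa only [mul_comm] using I3) I2]
    congr 1 with x
    simp only [PiLp.add_apply, PiLp.smul_apply, smul_eq_mul]
    ring
  rw [g1, g2]
  linarith

/-! ### Averaging operators on weighted Lebesgue spaces -/

theorem measurable_lintegral_ball {N : ℕ} (r : ℝ) {g : Eucl N → ℝ≥0∞} (hg : Measurable g) :
    Measurable fun x => ∫⁻ y in ball x r, g y := by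
  have hs : MeasurableSet {z : Eucl N × Eucl N | dist z.2 z.1 < r} :=
    measurableSet_lt (measurable_snd.dist measurable_fst) measurable_const
  have h : Measurable fun z : Eucl N × Eucl N =>
      ({z : Eucl N × Eucl N | dist z.2 z.1 < r}).indicator (fun z => g z.2) z :=
    (hg.comp measurable_snd).indicator hs
  have e : (fun x => ∫⁻ y in ball x r, g y) = fun x => ∫⁻ y,
      ({z : Eucl N × Eucl N | dist z.2 z.1 < r}).indicator (fun z => g z.2) (x, y) := by
    funext x
    rw [← lintegral_indicator measurableSet_ball]
    rfl
  rw [e]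
  exact h.lintegral_prod_right'

theorem lintegral_mul_lintegral_ball_swap {N : ℕ} (r : ℝ) {f g : Eucl N → ℝ≥0∞}
    (hf : Measurable f) (hg : Measurable g) :
    ∫⁻ x, f x * ∫⁻ y in ball x r, g y = ∫⁻ y, g y * ∫⁻ x in ball y r, f x := by
  have hs : MeasurableSet {z : Eucl N × Eucl N | dist z.2 z.1 < r} :=
    measurableSet_lt (measurable_snd.dist measurable_fst) measurable_const
  have h : Measurable fun z : Eucl N × Eucl N =>
      ({z : Eucl N × Eucl N | dist z.2 z.1 < r}).indicator (fun z => f z.1 * g z.2) z :=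
    ((hf.comp measurable_fst).mul (hg.comp measurable_snd)).indicator hs
  have e1 : ∀ x, f x * ∫⁻ y in ball x r, g y = ∫⁻ y,
      ({z : Eucl N × Eucl N | dist z.2 z.1 < r}).indicator (fun z => f z.1 * g z.2) (x, y) := by
    intro x
    rw [← lintegral_const_mul _ hg, ← lintegral_indicator measurableSet_ball]
    rfl
  have e2 : ∀ y, g y * ∫⁻ x in ball y r, f x = ∫⁻ x,
      ({z : Eucl N × Eucl N | dist z.2 z.1 < r}).indicator (fun z => f z.1 * g z.2) (x, y) := by
    intro y
    rw [← lintegral_const_mul _ hf, ← lintegral_indicator measurableSet_ball]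
    congr 1 with x
    simp only [indicator, mem_ball, mem_ofPred_eq, dist_comm x y, mul_comm (g y)]
  simp_rw [e1, e2]
  exact lintegral_lintegral_swap h.aemeasurable

theorem volume_ball_eq {N : ℕ} (x : Eucl N) (r : ℝ) :
    volume (ball x r) = volume (ball (0 : Eucl N) r) := Measure.addHaar_ball_center _ _ _

/-- Hölder's inequality in the form that underlies Muckenhoupt's condition. -/
theorem rpow_lintegral_le_weighted {α : Type*} [MeasurableSpace α] {μ : Measure α}
    {q : ℝ} (hq : 1 < q) {W h : α → ℝ≥0∞} (hW : Measurable W) (hh : Measurable h)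
    (hW0 : ∀ᵐ x ∂μ, W x ≠ 0) (hWt : ∀ᵐ x ∂μ, W x ≠ ∞) :
    (∫⁻ x, h x ∂μ) ^ q ≤
      (∫⁻ x, W x * h x ^ q ∂μ) * (∫⁻ x, W x ^ (-(1 / (q - 1))) ∂μ) ^ (q - 1) := by
  have hq0 : 0 < q := by linarith
  have hq1 : 0 < q - 1 := by linarith
  have hc : q.HolderConjugate (q / (q - 1)) := Real.HolderConjugate.conjExponent hq
  have hH := ENNReal.lintegral_mul_le_Lp_mul_Lq μ hc
    (f := fun x => W x ^ (1 / q) * h x) (g := fun x => W x ^ (-(1 / q)))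
    ((hW.pow_const _).mul hh).aemeasurable (hW.pow_const _).aemeasurable
  have e0 : ∫⁻ x, h x ∂μ =
      ∫⁻ x, ((fun x => W x ^ (1 / q) * h x) * fun x => W x ^ (-(1 / q))) x ∂μ := by
    refine lintegral_congr_ae ?_
    filter_upwards [hW0, hWt] with x h0 ht
    rw [Pi.mul_apply, mul_right_comm, ← ENNReal.rpow_add _ _ h0 ht]
    simp
  have e1 : ∀ x, (W x ^ (1 / q) * h x) ^ q = W x * h x ^ q := fun x => by
    rw [ENNReal.mul_rpow_of_nonneg _ _ hq0.le, ← ENNReal.rpow_mul, one_div_mul_cancel hq0.ne',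
      ENNReal.rpow_one]
  have e2 : ∀ x, (W x ^ (-(1 / q))) ^ (q / (q - 1)) = W x ^ (-(1 / (q - 1))) := fun x => by
    rw [← ENNReal.rpow_mul]
    congr 1
    field_simp
  simp only [e1, e2] at hH
  calc (∫⁻ x, h x ∂μ) ^ q ≤ ((∫⁻ x, W x * h x ^ q ∂μ) ^ (1 / q) *
        (∫⁻ x, W x ^ (-(1 / (q - 1))) ∂μ) ^ (1 / (q / (q - 1)))) ^ q := by
        rw [e0]
        exact ENNReal.rpow_le_rpow hH hq0.le
    _ = _ := by
        rw [ENNReal.mul_rpow_of_nonneg _ _ hq0.le, ← ENNReal.rpow_mul, ← ENNReal.rpow_mul,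
          one_div_mul_cancel hq0.ne', ENNReal.rpow_one]
        congr 2
        field_simp

theorem rpow_lintegral_le_measure_univ {α : Type*} [MeasurableSpace α] {μ : Measure α}
    {p : ℝ} (hp : 1 ≤ p) {h : α → ℝ≥0∞} (hh : Measurable h) :
    (∫⁻ x, h x ∂μ) ^ p ≤ μ univ ^ (p - 1) * ∫⁻ x, h x ^ p ∂μ := by
  rcases hp.eq_or_lt with rfl | hp
  · simp
  · have := rpow_lintegral_le_weighted (μ := μ) hp (W := fun _ => 1) measurable_const hh
      (by simp) (by simp)
    simpa [mul_comm] using this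

/-- Integration over balls of radius `r` is bounded on `L^p`. -/
theorem lintegral_rpow_lintegral_ball_le {N : ℕ} (r : ℝ) {p : ℝ} (hp : 1 ≤ p)
    {h : Eucl N → ℝ≥0∞} (hh : Measurable h) :
    ∫⁻ x, (∫⁻ y in ball x r, h y) ^ p ≤ volume (ball (0 : Eucl N) r) ^ p * ∫⁻ x, h x ^ p := by
  have hV : volume (ball (0 : Eucl N) r) ≠ ∞ := measure_ball_lt_top.ne
  set V := volume (ball (0 : Eucl N) r)
  have hp0 : 0 ≤ p - 1 := by linarith
  calc ∫⁻ x, (∫⁻ y in ball x r, h y) ^ p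
      ≤ ∫⁻ x, V ^ (p - 1) * ∫⁻ y in ball x r, h y ^ p := by
        refine lintegral_mono fun x => ?_
        have := rpow_lintegral_le_measure_univ (μ := volume.restrict (ball x r)) hp hh
        rwa [Measure.restrict_apply_univ, volume_ball_eq] at this
    _ = V ^ (p - 1) * ∫⁻ x, 1 * ∫⁻ y in ball x r, h y ^ p := by
        rw [lintegral_const_mul' _ _ (ENNReal.rpow_ne_top_of_nonneg hp0 hV)]
        simp
    _ = V ^ (p - 1) * ∫⁻ y, h y ^ p * V := by
        rw [lintegral_mul_lintegral_ball_swap r measurable_const (hh.pow_const p)]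
        simp only [lintegral_const, Measure.restrict_apply_univ, one_mul, volume_ball_eq _ r]
        rfl
    _ = V ^ p * ∫⁻ x, h x ^ p := by
        rw [lintegral_mul_const' _ _ hV, mul_comm (∫⁻ x, h x ^ p), ← mul_assoc]
        congr 1
        nth_rewrite 2 [← ENNReal.rpow_one V]
        rw [← ENNReal.rpow_add_of_nonneg _ _ hp0 zero_le_one]
        simp

/-- Muckenhoupt's condition on the balls contained in `U`, in terms of integrals instead of
averages. -/
def MuckenhouptBound {N : ℕ} (q : ℝ) (U : Set (Eucl N)) (K : ℝ≥0) (W : Eucl N → ℝ≥0∞) : Prop :=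
  ∀ (x : Eucl N) (ρ : ℝ), 0 < ρ → ball x ρ ⊆ U →
    (∫⁻ z in ball x ρ, W z) * (∫⁻ z in ball x ρ, W z ^ (-(1 / (q - 1)))) ^ (q - 1) ≤
      K * volume (ball (0 : Eucl N) ρ) ^ q

/-- A point outside the zero set of `W` almost surely sees the mass of `W` in every small ball. -/
theorem ae_eq_zero_or_lintegral_ball_ne_zero {N : ℕ} {r : ℝ} (hr : 0 < r) {W : Eucl N → ℝ≥0∞}
    (hW : Measurable W) : ∀ᵐ x, W x = 0 ∨ ∫⁻ y in ball x r, W y ≠ 0 := by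
  rw [ae_iff]
  refine measure_null_of_locally_null _ fun x hx => ?_
  simp only [not_or, not_not, mem_ofPred_eq] at hx
  obtain ⟨-, hx⟩ := hx
  refine ⟨{x | ¬(W x = 0 ∨ ∫⁻ y in ball x r, W y ≠ 0)} ∩ ball x r,
    Filter.inter_mem self_mem_nhdsWithin (mem_nhdsWithin_of_mem_nhds (ball_mem_nhds x hr)), ?_⟩
  rw [lintegral_eq_zero_iff hW, Filter.EventuallyEq, ae_restrict_iff' measurableSet_ball,
    ae_iff] at hx
  refine measure_mono_null ?_ hx
  rintro y ⟨hy, hyb⟩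
  simp only [not_or, not_not, mem_ofPred_eq] at hy
  simp only [mem_ofPred_eq, Classical.not_imp]
  exact ⟨hyb, hy.1⟩

/-- Integration over balls of radius `r` is bounded on `L^q(W)` when `W` is a Muckenhoupt weight.
Only the fixed-scale averages occur, so Fubini's theorem replaces the maximal theorem. -/
theorem lintegral_weight_mul_rpow_lintegral_ball_le {N : ℕ} {r : ℝ} (hr : 0 < r) {q : ℝ}
    (hq : 1 < q) {U Ω : Set (Eucl N)} (hΩ : MeasurableSet Ω)
    (hΩU : ∀ y ∈ Ω, ball y (2 * r) ⊆ U) {K : ℝ≥0} {W h : Eucl N → ℝ≥0∞} (hW : Measurable W)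
    (hWt : ∀ x, W x ≠ ∞) (hK : MuckenhouptBound q U K W) (hh : Measurable h)
    (hh0 : ∀ x ∉ Ω, h x = 0) :
    ∫⁻ x in Ω, W x * (∫⁻ y in ball x r, h y) ^ q ≤
      K * volume (ball (0 : Eucl N) (2 * r)) ^ q * ∫⁻ x in Ω, W x * h x ^ q := by
  have hq0 : 0 < q := by linarith
  have hq1 : 0 < q - 1 := by linarith
  set W' : Eucl N → ℝ≥0∞ := fun z => W z ^ (-(1 / (q - 1))) with hW'
  have mW' : Measurable W' := hW.pow_const _
  set D : Eucl N → ℝ≥0∞ := fun x => (∫⁻ y in ball x r, W' y) ^ (q - 1) with hD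
  have mD : Measurable D := (measurable_lintegral_ball r mW').pow_const _
  have mg : Measurable fun y => W y * h y ^ q := hW.mul (hh.pow_const q)
  have hpt : ∀ᵐ x ∂volume.restrict Ω, W x * (∫⁻ y in ball x r, h y) ^ q ≤
      (W x * D x) * ∫⁻ y in ball x r, W y * h y ^ q := by
    filter_upwards [ae_restrict_of_ae (ae_eq_zero_or_lintegral_ball_ne_zero hr hW),
      ae_restrict_mem hΩ] with x hx hxΩ
    rcases hx with hx | hx
    · simp [hx]
    have hsub : ball x r ⊆ U := (ball_subset_ball (by linarith)).trans (hΩU x hxΩ)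
    have hfin : ∫⁻ y in ball x r, W' y ≠ ∞ := by
      intro htop
      have h1 := hK x r hr hsub
      change _ * (∫⁻ y in ball x r, W' y) ^ (q - 1) ≤ _ at h1
      rw [htop, ENNReal.top_rpow_of_pos hq1, ENNReal.mul_top hx, top_le_iff] at h1
      exact ENNReal.mul_ne_top ENNReal.coe_ne_top
        (ENNReal.rpow_ne_top_of_nonneg hq0.le measure_ball_lt_top.ne) h1
    have hne : ∀ᵐ y ∂volume.restrict (ball x r), W y ≠ 0 := by
      filter_upwards [ae_lt_top mW' hfin] with y hy h0
      simp only [hW', h0] at hy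
      rw [ENNReal.zero_rpow_of_neg (by simpa using hq)] at hy
      exact lt_irrefl _ hy
    have := rpow_lintegral_le_weighted (μ := volume.restrict (ball x r)) hq hW hh hne
      (Filter.Eventually.of_forall hWt)
    rw [mul_assoc]
    gcongr
    rw [mul_comm (D x)]
    exact this
  calc ∫⁻ x in Ω, W x * (∫⁻ y in ball x r, h y) ^ q
      ≤ ∫⁻ x in Ω, (W x * D x) * ∫⁻ y in ball x r, W y * h y ^ q := lintegral_mono_ae hpt
    _ = ∫⁻ x, (Ω.indicator fun x => W x * D x) x * ∫⁻ y in ball x r, W y * h y ^ q := by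
        rw [← lintegral_indicator hΩ]
        congr 1 with x
        by_cases hx : x ∈ Ω <;> simp [hx]
    _ = ∫⁻ y, (W y * h y ^ q) * ∫⁻ x in ball y r, (Ω.indicator fun x => W x * D x) x :=
        lintegral_mul_lintegral_ball_swap r ((hW.mul mD).indicator hΩ) mg
    _ ≤ ∫⁻ y, (K * volume (ball (0 : Eucl N) (2 * r)) ^ q) *
          (Ω.indicator fun y => W y * h y ^ q) y := by
        refine lintegral_mono fun y => ?_
        by_cases hy : y ∈ Ω
        · rw [indicator_of_mem hy, mul_comm]
          gcongr
          calc ∫⁻ x in ball y r, (Ω.indicator fun x => W x * D x) x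
              ≤ ∫⁻ x in ball y r, W x * (∫⁻ z in ball y (2 * r), W' z) ^ (q - 1) := by
                refine setLIntegral_mono' measurableSet_ball fun x hx => ?_
                refine (indicator_le_self _ _ x).trans ?_
                refine mul_le_mul_right (ENNReal.rpow_le_rpow
                  (lintegral_mono_set fun z hz => ?_) hq1.le) _
                have h1 := mem_ball.1 hz
                have h2 := mem_ball.1 hx
                rw [mem_ball]
                linarith [dist_triangle z x y]
            _ ≤ (∫⁻ x in ball y (2 * r), W x) * (∫⁻ z in ball y (2 * r), W' z) ^ (q - 1) := by
                rw [lintegral_mul_const _ hW]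
                gcongr
                linarith
            _ ≤ _ := hK y (2 * r) (by linarith) (hΩU y hy)
        · simp [hh0 y hy, ENNReal.zero_rpow_of_pos hq0]
    _ = _ := by
        rw [lintegral_const_mul _ (mg.indicator hΩ), lintegral_indicator hΩ]

/-- A weight of class `A_q(U)` agrees almost everywhere on `U` with a Borel measurable weight that
is finite and satisfies Muckenhoupt's condition. -/
theorem MemMuckenhoupt.exists_measurable {N : ℕ} {q : ℝ} (hq : 1 < q) {U : Set (Eucl N)}
    {ω : Eucl N → ℝ} (h : MemMuckenhoupt q U ω) :
    ∃ (W : Eucl N → ℝ≥0∞) (K : ℝ≥0), Measurable W ∧ (∀ x, W x ≠ ∞) ∧ MuckenhouptBound q U K W ∧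
      ∀ᵐ x ∂volume.restrict U, W x = ENNReal.ofReal (ω x) := by
  obtain ⟨-, hm, K, hK⟩ := h
  have hq1 : 0 < q - 1 := by linarith
  refine ⟨fun x => ENNReal.ofReal (hm.mk ω x), K, hm.measurable_mk.ennreal_ofReal,
    fun x => ENNReal.ofReal_ne_top, fun x ρ hρ hsub => ?_, ?_⟩
  · have e : ∀ᵐ z ∂volume.restrict (ball x ρ), hm.mk ω z = ω z :=
      ae_restrict_of_ae_restrict_of_subset hsub (hm.ae_eq_mk.symm)
    have e1 : ∫⁻ z in ball x ρ, ENNReal.ofReal (hm.mk ω z) =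
        ∫⁻ z in ball x ρ, ENNReal.ofReal (ω z) :=
      lintegral_congr_ae (by filter_upwards [e] with z hz; rw [hz])
    have e2 : ∫⁻ z in ball x ρ, ENNReal.ofReal (hm.mk ω z) ^ (-(1 / (q - 1))) =
        ∫⁻ z in ball x ρ, ENNReal.ofReal (ω z) ^ (-(1 / (q - 1))) :=
      lintegral_congr_ae (by filter_upwards [e] with z hz; rw [hz])
    have hB := hK x ρ hρ hsub
    have hV0 : volume (ball (0 : Eucl N) ρ) ≠ 0 := (measure_ball_pos _ _ hρ).ne'
    have hVt : volume (ball (0 : Eucl N) ρ) ≠ ∞ := measure_ball_lt_top.ne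
    rw [setLAverage_eq, setLAverage_eq, volume_ball_eq, ENNReal.div_rpow_of_nonneg _ _ hq1.le] at hB
    rw [e1, e2]
    set V := volume (ball (0 : Eucl N) ρ)
    set A := ∫⁻ z in ball x ρ, ENNReal.ofReal (ω z)
    set B := (∫⁻ z in ball x ρ, ENNReal.ofReal (ω z) ^ (-(1 / (q - 1)))) ^ (q - 1)
    have hVq : V ^ q = V * V ^ (q - 1) := by
      nth_rewrite 2 [← ENNReal.rpow_one V]
      rw [← ENNReal.rpow_add _ _ hV0 hVt]
      simp
    have hVq0 : V ^ (q - 1) ≠ 0 := by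
      simp [ENNReal.rpow_eq_zero_iff, hV0, hVt]
    have hVqt : V ^ (q - 1) ≠ ∞ := ENNReal.rpow_ne_top_of_nonneg hq1.le hVt
    calc A * B = (A / V * V) * (B / V ^ (q - 1) * V ^ (q - 1)) := by
          rw [ENNReal.div_mul_cancel hV0 hVt, ENNReal.div_mul_cancel hVq0 hVqt]
      _ = (A / V * (B / V ^ (q - 1))) * V ^ q := by rw [hVq]; ring
      _ ≤ K * V ^ q := by gcongr
  · filter_upwards [hm.ae_eq_mk] with x hx
    rw [hx]

/-! ### Mollification with an off-centre kernel -/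

/-- A smooth nonnegative kernel of mass one that vanishes outside `ball 0 R`. It need not be
centred at the origin: mollifying with a kernel concentrated near `e` also translates by `e`. -/
structure IsMollifier {N : ℕ} (k : Eucl N → ℝ) (R : ℝ) : Prop where
  contDiff : ContDiff ℝ (⊤ : ℕ∞) k
  nonneg : ∀ z, 0 ≤ k z
  integral_eq_one : ∫ z, k z = 1
  norm_lt : ∀ z, k z ≠ 0 → ‖z‖ < R

/-- The rescaled kernel `δ⁻ᴺ k(z / δ)`. -/
noncomputable def rescale {N : ℕ} (k : Eucl N → ℝ) (δ : ℝ) (z : Eucl N) : ℝ :=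
  (δ⁻¹) ^ N * k (δ⁻¹ • z)

/-- The convolution `k * w`. -/
noncomputable def mollify {N : ℕ} (k w : Eucl N → ℝ) (x : Eucl N) : ℝ := ∫ y, k (x - y) * w y

theorem IsMollifier.hasCompactSupport {N : ℕ} {k : Eucl N → ℝ} {R : ℝ} (h : IsMollifier k R) :
    HasCompactSupport k := by
  refine HasCompactSupport.intro (isCompact_closedBall (0 : Eucl N) R) fun z hz => ?_
  by_contra h0
  exact hz (mem_closedBall_zero_iff.2 (h.norm_lt z h0).le)

theorem IsMollifier.rescale {N : ℕ} {k : Eucl N → ℝ} {R : ℝ} (h : IsMollifier k R) {δ : ℝ}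
    (hδ : 0 < δ) : IsMollifier (rescale k δ) (R * δ) := by
  refine ⟨contDiff_const.mul (h.contDiff.comp (contDiff_const_smul _)),
    fun z => mul_nonneg (by positivity) (h.nonneg _), ?_, fun z hz => ?_⟩
  · simp only [_root_.rescale]
    rw [integral_const_mul, Measure.integral_comp_smul, h.integral_eq_one, finrank_euclideanSpace_fin,
      abs_of_nonneg (by positivity), smul_eq_mul, mul_one]
    exact mul_inv_cancel₀ (by positivity)
  · have := h.norm_lt _ (right_ne_zero_of_mul hz)
    rw [norm_smul, norm_inv, Real.norm_of_nonneg hδ.le, inv_mul_lt_iff₀ hδ] at this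
    linarith

theorem exists_isMollifier {N : ℕ} (e : Eucl N) {c : ℝ} (hc : 0 < c) :
    ∃ k : Eucl N → ℝ, IsMollifier k (‖e‖ + 2 * c) ∧ ∀ z, k z ≠ 0 → z ∈ closedBall e c := by
  let f : ContDiffBump e := ⟨c / 2, c, by linarith, by linarith⟩
  have hsupp : ∀ z, f.normed volume z ≠ 0 → z ∈ closedBall e c := fun z hz => by
    have : z ∈ tsupport (f.normed volume) := subset_tsupport _ hz
    rwa [f.tsupport_normed_eq] at this
  refine ⟨f.normed volume, ⟨f.contDiff_normed, f.nonneg_normed, f.integral_normed,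
    fun z hz => ?_⟩, hsupp⟩
  have h1 := mem_closedBall_iff_norm.1 (hsupp z hz)
  have h2 := norm_le_norm_add_norm_sub' z e
  linarith

theorem mollify_eq_convolution {N : ℕ} (k w : Eucl N → ℝ) :
    mollify k w = convolution k w (ContinuousLinearMap.lsmul ℝ ℝ) volume := by
  funext x
  rw [convolution_eq_swap]
  simp [mollify]

theorem IsMollifier.contDiff_mollify {N : ℕ} {k w : Eucl N → ℝ} {R : ℝ} (h : IsMollifier k R)
    (hw : LocallyIntegrable w) : ContDiff ℝ (⊤ : ℕ∞) (mollify k w) := by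
  rw [mollify_eq_convolution]
  exact h.hasCompactSupport.contDiff_convolution_left _ h.contDiff hw

theorem IsMollifier.contDiff_one {N : ℕ} {k : Eucl N → ℝ} {R : ℝ} (h : IsMollifier k R) :
    ContDiff ℝ 1 k := h.contDiff.of_le (by exact_mod_cast le_top)

theorem IsMollifier.fderiv_mollify_apply {N : ℕ} {k w : Eucl N → ℝ} {R : ℝ} (h : IsMollifier k R)
    (hw : LocallyIntegrable w) (x e : Eucl N) :
    fderiv ℝ (mollify k w) x e = ∫ y, fderiv ℝ k (x - y) e * w y := by
  have hd := h.hasCompactSupport.hasFDerivAt_convolution_left (ContinuousLinearMap.lsmul ℝ ℝ)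
    h.contDiff_one hw x
  rw [mollify_eq_convolution, hd.fderiv, convolution_eq_swap, ContinuousLinearMap.integral_apply]
  · simp [ContinuousLinearMap.precompL_apply]
  · have := (h.hasCompactSupport.fderiv (𝕜 := ℝ)).convolutionExists_left
      (ContinuousLinearMap.precompL (Eucl N) (ContinuousLinearMap.lsmul ℝ ℝ))
      (h.contDiff_one.continuous_fderiv one_ne_zero) hw x
    exact this.integrable_swap

/-- The translate-and-reflect `y ↦ k (x - y)` of a mollifier is a test function. -/
theorem IsMollifier.isTestFunction_comp_sub {N : ℕ} {k : Eucl N → ℝ} {R : ℝ}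
    (h : IsMollifier k R) (x : Eucl N) : IsTestFunction univ fun y => k (x - y) :=
  ⟨h.contDiff.comp (contDiff_const.sub contDiff_id),
    h.hasCompactSupport.comp_homeomorph (Homeomorph.subLeft x), subset_univ _⟩

theorem integral_euclidean_apply {N : ℕ} {f : Eucl N → Eucl N} (hf : Integrable f) (i : Fin N) :
    (∫ y, f y) i = ∫ y, f y i :=
  ((EuclideanSpace.proj i : Eucl N →L[ℝ] ℝ).integral_comp_comm hf).symm

theorem IsMollifier.integrable_smul {N : ℕ} {k : Eucl N → ℝ} {R : ℝ} (h : IsMollifier k R)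
    {H : Eucl N → Eucl N} (hH : LocallyIntegrable H) (x : Eucl N) :
    Integrable fun y => k (x - y) • H y :=
  hH.integrable_smul_left_of_hasCompactSupport (h.isTestFunction_comp_sub x).1.continuous
    (h.isTestFunction_comp_sub x).2.1

/-- The gradient of a mollification is the mollification of the weak gradient. -/
theorem IsMollifier.gradient_mollify {N : ℕ} {k w : Eucl N → ℝ} {R : ℝ} (h : IsMollifier k R)
    {H : Eucl N → Eucl N} (hw : IsWeakGradient univ w H) (x : Eucl N) :
    gradient (mollify k w) x = ∫ y, k (x - y) • H y := by
  have l1 : LocallyIntegrable w := locallyIntegrableOn_univ.1 hw.1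
  have l2 : LocallyIntegrable H := locallyIntegrableOn_univ.1 hw.2.1
  ext i
  have hT := h.isTestFunction_comp_sub x
  have h1 := hw.2.2 _ hT i
  rw [gradient_apply_eq_fderiv, h.fderiv_mollify_apply l1,
    integral_euclidean_apply (h.integrable_smul l2 x)]
  simp only [setIntegral_univ] at h1
  have hfd : ∀ y, fderiv ℝ (fun y => k (x - y)) y (EuclideanSpace.single i 1) =
      -fderiv ℝ k (x - y) (EuclideanSpace.single i 1) := by
    intro y
    have hd := ((h.contDiff_one.differentiable one_ne_zero (x - y)).hasFDerivAt).comp y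
      ((hasFDerivAt_id y).const_sub x)
    refine (congrArg (fun L => L (EuclideanSpace.single i 1)) hd.fderiv).trans ?_
    simp
  simp only [hfd, mul_neg, integral_neg, neg_inj] at h1
  simp only [PiLp.smul_apply, smul_eq_mul]
  rw [← h1]
  simp only [mul_comm]

theorem IsMollifier.exists_le {N : ℕ} {k : Eucl N → ℝ} {R : ℝ} (h : IsMollifier k R) :
    ∃ C : ℝ, 0 ≤ C ∧ ∀ z, k z ≤ C := by
  obtain ⟨C, hC⟩ := h.contDiff.continuous.bounded_above_of_compact_support h.hasCompactSupport
  exact ⟨C, (norm_nonneg _).trans (hC 0), fun z => (le_abs_self _).trans (hC z)⟩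

theorem IsMollifier.norm_rescale_le {N : ℕ} {k : Eucl N → ℝ} {R C : ℝ} (h : IsMollifier k R)
    (hC : ∀ z, k z ≤ C) {δ : ℝ} (hδ : 0 < δ) (x y : Eucl N) :
    ‖_root_.rescale k δ (x - y)‖ ≤ (ball x (R * δ)).indicator (fun _ => C * (δ⁻¹) ^ N) y := by
  by_cases hy : y ∈ ball x (R * δ)
  · rw [indicator_of_mem hy, Real.norm_of_nonneg ((h.rescale hδ).nonneg _), _root_.rescale, mul_comm]
    exact mul_le_mul_of_nonneg_right (hC _) (by positivity)
  · rw [indicator_of_notMem hy]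
    by_contra h0
    refine hy ?_
    rw [mem_ball_iff_norm']
    refine (h.rescale hδ).norm_lt _ fun h1 => h0 ?_
    rw [h1, norm_zero]

theorem enorm_integral_rescale_smul_le {N : ℕ} {k : Eucl N → ℝ} {R C : ℝ} (h : IsMollifier k R)
    (hC : ∀ z, k z ≤ C) {δ : ℝ} (hδ : 0 < δ) (F : Eucl N → Eucl N) (x : Eucl N) :
    ‖∫ y, rescale k δ (x - y) • F y‖ₑ ≤
      ENNReal.ofReal (C * (δ⁻¹) ^ N) * ∫⁻ y in ball x (R * δ), ‖F y‖ₑ := by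
  refine (enorm_integral_le_lintegral_enorm _).trans ?_
  rw [← lintegral_const_mul' _ _ ENNReal.ofReal_ne_top, ← lintegral_indicator measurableSet_ball]
  refine lintegral_mono fun y => ?_
  have h1 := h.norm_rescale_le hC hδ x y
  rw [enorm_smul]
  by_cases hy : y ∈ ball x (R * δ)
  · rw [indicator_of_mem hy] at h1 ⊢
    gcongr
    rw [← ofReal_norm]
    exact ENNReal.ofReal_le_ofReal h1
  · rw [indicator_of_notMem hy] at h1
    rw [indicator_of_notMem hy, norm_le_zero_iff.1 h1]
    simp

theorem IsMollifier.enorm_gradient_mollify_le {N : ℕ} {k w : Eucl N → ℝ} {R C : ℝ}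
    (h : IsMollifier k R) (hC : ∀ z, k z ≤ C) {H : Eucl N → Eucl N}
    (hw : IsWeakGradient univ w H) {δ : ℝ} (hδ : 0 < δ) (x : Eucl N) :
    ‖gradient (mollify (_root_.rescale k δ) w) x‖ₑ ≤
      ENNReal.ofReal (C * (δ⁻¹) ^ N) * ∫⁻ y in ball x (R * δ), ‖H y‖ₑ := by
  rw [(h.rescale hδ).gradient_mollify hw]
  exact enorm_integral_rescale_smul_le h hC hδ H x

theorem IsMollifier.exists_norm_gradient_mollify_le_div {N : ℕ} {k : Eucl N → ℝ} {R : ℝ}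
    (h : IsMollifier k R) : ∃ C : ℝ, 0 ≤ C ∧ ∀ (w : Eucl N → ℝ) (M δ : ℝ), LocallyIntegrable w →
      (∀ x, |w x| ≤ M) → 0 < δ → ∀ x, ‖gradient (mollify (_root_.rescale k δ) w) x‖ ≤
        C * M * δ⁻¹ := by
  refine ⟨∫ z, ‖fderiv ℝ k z‖, integral_nonneg fun _ => norm_nonneg _, fun w M δ hw hM hδ x => ?_⟩
  have hM0 : 0 ≤ M := (abs_nonneg _).trans (hM 0)
  have hi : ∫ z, ‖fderiv ℝ (_root_.rescale k δ) z‖ = δ⁻¹ * ∫ z, ‖fderiv ℝ k z‖ := by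
    have e1 : ∀ z, ‖fderiv ℝ (_root_.rescale k δ) z‖ =
        (δ⁻¹) ^ N * δ⁻¹ * ‖fderiv ℝ k (δ⁻¹ • z)‖ := by
      intro z
      have hd : HasFDerivAt (_root_.rescale k δ)
          ((δ⁻¹) ^ N • ((fderiv ℝ k (δ⁻¹ • z)).comp (δ⁻¹ • ContinuousLinearMap.id ℝ (Eucl N)))) z :=
        ((h.contDiff_one.differentiable one_ne_zero _).hasFDerivAt.comp z
          ((hasFDerivAt_id z).const_smul δ⁻¹)).const_mul _
      rw [hd.fderiv, ContinuousLinearMap.comp_smul, ContinuousLinearMap.comp_id, smul_smul,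
        norm_smul, Real.norm_of_nonneg (by positivity)]
    simp only [e1]
    rw [integral_const_mul, Measure.integral_comp_smul (μ := volume) (fun z => ‖fderiv ℝ k z‖),
      finrank_euclideanSpace_fin, abs_of_nonneg (by positivity), smul_eq_mul]
    field_simp
  have hint : Integrable fun z => ‖fderiv ℝ (_root_.rescale k δ) z‖ :=
    (((h.rescale hδ).contDiff_one.continuous_fderiv one_ne_zero).integrable_of_hasCompactSupport
      ((h.rescale hδ).hasCompactSupport.fderiv (𝕜 := ℝ))).norm
  rw [norm_gradient_eq]
  refine ContinuousLinearMap.opNorm_le_bound _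
    (by have : 0 ≤ ∫ z, ‖fderiv ℝ k z‖ := integral_nonneg fun _ => norm_nonneg _
        positivity) fun e => ?_
  rw [(h.rescale hδ).fderiv_mollify_apply hw]
  calc ‖∫ y, fderiv ℝ (_root_.rescale k δ) (x - y) e * w y‖
      ≤ ∫ y, ‖fderiv ℝ (_root_.rescale k δ) (x - y)‖ * (‖e‖ * M) := by
        refine norm_integral_le_of_norm_le ((hint.comp_sub_left x).mul_const _)
          (Filter.Eventually.of_forall fun y => ?_)
        rw [norm_mul, ← mul_assoc]
        exact mul_le_mul (ContinuousLinearMap.le_opNorm _ _) (hM y) (norm_nonneg _) (by positivity)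
    _ = (∫ z, ‖fderiv ℝ k z‖) * M * δ⁻¹ * ‖e‖ := by
        rw [integral_mul_const,
          integral_sub_left_eq_self (fun z => ‖fderiv ℝ (_root_.rescale k δ) z‖) volume x, hi]
        ring

theorem volume_ball_mul {N : ℕ} (hN : 1 ≤ N) (R : ℝ) {δ : ℝ} (hδ : 0 ≤ δ) :
    volume (ball (0 : Eucl N) (R * δ)) = ENNReal.ofReal (δ ^ N) * volume (ball (0 : Eucl N) R) := by
  have : Nonempty (Fin N) := ⟨⟨0, hN⟩⟩
  have h := Measure.addHaar_ball_mul (volume : Measure (Eucl N)) (0 : Eucl N) hδ R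
  rwa [finrank_euclideanSpace_fin, mul_comm] at h

/-- At almost every point (at the Lebesgue points of `H`), the mollifications converge. -/
theorem IsMollifier.ae_tendsto_gradient_mollify {N : ℕ} {k w : Eucl N → ℝ}
    {R : ℝ} (hR : 0 < R) (h : IsMollifier k R) {H : Eucl N → Eucl N}
    (hw : IsWeakGradient univ w H) :
    ∀ᵐ x, Filter.Tendsto (fun n : ℕ =>
      gradient (mollify (_root_.rescale k ((n : ℝ) + 1)⁻¹) w) x) Filter.atTop (nhds (H x)) := by
  have l2 : LocallyIntegrable H := locallyIntegrableOn_univ.1 hw.2.1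
  obtain ⟨C, hC0, hC⟩ := h.exists_le
  filter_upwards [IsUnifLocDoublingMeasure.ae_tendsto_average_norm_sub volume l2 1] with x hx
  set δ : ℕ → ℝ := fun n => ((n : ℝ) + 1)⁻¹ with hδ
  have hδ0 : ∀ n, 0 < δ n := fun n => by positivity
  have hlim : Filter.Tendsto (fun n => R * δ n) Filter.atTop (nhdsWithin 0 (Ioi 0)) := by
    rw [tendsto_nhdsWithin_iff]
    refine ⟨?_, Filter.Eventually.of_forall fun n => mul_pos hR (hδ0 n)⟩
    have := tendsto_one_div_add_atTop_nhds_zero_nat (𝕜 := ℝ) |>.const_mul R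
    simpa [hδ] using this
  have hav := hx (fun _ => x) (fun n => R * δ n) hlim (Filter.Eventually.of_forall fun n =>
    mem_closedBall_self (by rw [one_mul]; exact (mul_pos hR (hδ0 n)).le))
  rw [tendsto_iff_norm_sub_tendsto_zero]
  set V := volume.real (closedBall (0 : Eucl N) R) with hV
  have hav2 := hav.const_mul (C * V)
  rw [mul_zero] at hav2
  refine squeeze_zero (fun n => norm_nonneg _) (fun n => ?_) hav2
  have hk := h.rescale (hδ0 n)
  have e1 : gradient (mollify (_root_.rescale k (δ n)) w) x - H x =
      ∫ y, _root_.rescale k (δ n) (x - y) • (H y - H x) := by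
    rw [hk.gradient_mollify hw]
    have i1 := hk.integrable_smul l2 x
    have i2 := hk.integrable_smul (locallyIntegrable_const (H x)) x
    simp only [smul_sub]
    rw [integral_sub i1 i2, integral_smul_const,
      integral_sub_left_eq_self (_root_.rescale k (δ n)) volume x, hk.integral_eq_one, one_smul]
  have iloc : IntegrableOn (fun y => ‖H y - H x‖) (closedBall x (R * δ n)) :=
    ((l2.sub (locallyIntegrable_const (H x))).integrableOn_isCompact
      (isCompact_closedBall _ _)).norm
  have hvol : volume.real (closedBall x (R * δ n)) = δ n ^ N * V := by
    have := Measure.addHaar_closedBall_mul (volume : Measure (Eucl N)) x (hδ0 n).le hR.le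
    rw [mul_comm R, measureReal_def, this, finrank_euclideanSpace_fin, ENNReal.toReal_mul,
      ENNReal.toReal_ofReal (by have := hδ0 n; positivity)]
    rfl
  have hVpos : 0 < V := by
    refine ENNReal.toReal_pos (measure_closedBall_pos _ _ hR).ne' measure_closedBall_lt_top.ne
  rw [e1, setAverage_eq, hvol, smul_eq_mul]
  calc ‖∫ y, _root_.rescale k (δ n) (x - y) • (H y - H x)‖
      ≤ ∫ y, (closedBall x (R * δ n)).indicator
          (fun y => C * ((δ n)⁻¹) ^ N * ‖H y - H x‖) y := by
        refine norm_integral_le_of_norm_le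
          (IntegrableOn.integrable_indicator (iloc.const_mul _) measurableSet_closedBall)
          (Filter.Eventually.of_forall fun y => ?_)
        rw [norm_smul]
        have h1 := h.norm_rescale_le hC (hδ0 n) x y
        by_cases hy : y ∈ ball x (R * δ n)
        · rw [indicator_of_mem hy] at h1
          rw [indicator_of_mem (ball_subset_closedBall hy)]
          gcongr
        · rw [indicator_of_notMem hy] at h1
          rw [le_antisymm h1 (norm_nonneg _), zero_mul]
          refine indicator_nonneg (fun y _ => ?_) y
          have := hδ0 n
          positivity
    _ = C * ((δ n)⁻¹) ^ N * ∫ y in closedBall x (R * δ n), ‖H y - H x‖ := by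
        rw [integral_indicator measurableSet_closedBall, integral_const_mul]
    _ = C * V * ((δ n ^ N * V)⁻¹ * ∫ y in closedBall x (R * δ n), ‖H y - H x‖) := by
        have := (hδ0 n).ne'
        rw [inv_pow, mul_inv]
        field_simp

open scoped Pointwise in
/-- If the points of `S` can be pushed into `Ω` along `t e` with room `c t` to spare, then
mollifying at scale `t` with a kernel concentrated in `closedBall e (c / 2)` maps functions that
vanish outside `S` to test functions on `Ω`. -/
theorem IsMollifier.isTestFunction_mollify {N : ℕ} {k w : Eucl N → ℝ} {R c t : ℝ}
    {e : Eucl N} (h : IsMollifier k R) (hk : ∀ z, k z ≠ 0 → z ∈ closedBall e (c / 2))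
    (hw : LocallyIntegrable w) {S Ω : Set (Eucl N)} (hS : Bornology.IsBounded S)
    (hw0 : ∀ x ∉ S, w x = 0) (hc : 0 < c) (ht : 0 < t)
    (hpush : ∀ y ∈ S, closedBall (y + t • e) (c * t) ⊆ Ω) :
    IsTestFunction Ω (mollify (_root_.rescale k t) w) := by
  set K : Set (Eucl N) := closure S + closedBall (t • e) (c / 2 * t) with hK
  have hKc : IsCompact K := hS.isCompact_closure.add (isCompact_closedBall _ _)
  have hKΩ : K ⊆ Ω := by
    rintro x ⟨y, hy, z, hz, rfl⟩
    obtain ⟨y', hy', hd⟩ := Metric.mem_closure_iff.1 hy (c / 2 * t) (by positivity)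
    refine hpush y' hy' ?_
    rw [mem_closedBall_iff_norm] at hz ⊢
    rw [dist_eq_norm] at hd
    have e1 : y + z - (y' + t • e) = (y - y') + (z - t • e) := by abel
    simp only [e1]
    exact (norm_add_le _ _).trans (by linarith)
  have hsupp : Function.support (mollify (_root_.rescale k t) w) ⊆ K := by
    intro x hx
    by_contra hxK
    refine hx ?_
    have : ∀ y, _root_.rescale k t (x - y) * w y = 0 := by
      intro y
      by_contra hne
      have hy : y ∈ S := by
        by_contra hyS
        exact hne (by rw [hw0 y hyS, mul_zero])
      have hz := hk _ (right_ne_zero_of_mul (left_ne_zero_of_mul hne))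
      refine hxK ⟨y, subset_closure hy, x - y, ?_, by simp⟩
      rw [mem_closedBall_iff_norm] at hz ⊢
      have e1 : x - y - t • e = t • (t⁻¹ • (x - y) - e) := by
        rw [smul_sub, smul_inv_smul₀ ht.ne']
      rw [e1, norm_smul, Real.norm_of_nonneg ht.le, mul_comm]
      gcongr
    simp [mollify, this]
  have htK : tsupport (mollify (_root_.rescale k t) w) ⊆ K :=
    closure_minimal hsupp hKc.isClosed
  exact ⟨(h.rescale ht).contDiff_mollify hw, hKc.of_isClosed_subset (isClosed_tsupport _) htK,
    htK.trans hKΩ⟩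

/-! ### Weights of class `Z^ϰ` -/

/-- A function of class `Z^ϰ` need not be measurable, but it is comparable to a Borel one: the
infimal convolution `x ↦ inf_y (σ y + |x - y|^ϰ)`, which is upper semicontinuous. -/
theorem MemZ.exists_measurable {N : ℕ} {κ : ℝ} (hκ : 0 < κ) {Ω : Set (Eucl N)} {σ : Eucl N → ℝ}
    (h : MemZ κ Ω σ) : ∃ (C : ℝ) (s : Eucl N → ℝ), 0 < C ∧ Measurable s ∧
      (∀ x ∈ Ω, s x ≤ σ x ∧ σ x ≤ C * s x) ∧
      ∀ x ∈ Ω, ∀ y ∈ Ω, σ x ≤ C * (σ y + ‖x - y‖ ^ κ) := by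
  obtain ⟨h0, C, hC⟩ := h
  have hnn : ∀ (x : Eucl N) (y : Ω), 0 ≤ σ y + ‖x - y‖ ^ κ := fun x y =>
    add_nonneg (h0 _ y.2) (by positivity)
  have hbdd : ∀ x : Eucl N, BddBelow (range fun y : Ω => σ y + ‖x - y‖ ^ κ) := fun x =>
    ⟨0, by rintro _ ⟨y, rfl⟩; exact hnn x y⟩
  have hC' : ∀ x ∈ Ω, ∀ y ∈ Ω, σ x ≤ max C 1 * (σ y + ‖x - y‖ ^ κ) := fun x hx y hy =>
    (hC x hx y hy).trans (mul_le_mul_of_nonneg_right (le_max_left _ _) (hnn x ⟨y, hy⟩))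
  have hpos : 0 < max C 1 := lt_max_of_lt_right one_pos
  refine ⟨max C 1, fun x => ⨅ y : Ω, (σ y + ‖x - y‖ ^ κ), hpos, ?_, fun x hx => ⟨?_, ?_⟩, hC'⟩
  · refine UpperSemicontinuous.measurable (upperSemicontinuous_ciInf hbdd fun y => ?_)
    refine Continuous.upperSemicontinuous ?_
    exact continuous_const.add
      ((continuous_id.sub continuous_const).norm.rpow_const fun _ => Or.inr hκ.le)
  · refine (ciInf_le (hbdd x) ⟨x, hx⟩).trans ?_
    simp [hκ.ne']
  · have : Nonempty Ω := ⟨⟨x, hx⟩⟩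
    rw [mul_comm, ← div_le_iff₀ hpos]
    refine le_ciInf fun y => ?_
    rw [div_le_iff₀ hpos, mul_comm]
    exact hC' x hx y y.2

theorem MemZ.exists_bound {N : ℕ} {κ : ℝ} (hκ : 0 < κ) {Ω : Set (Eucl N)}
    (hb : Bornology.IsBounded Ω) {σ : Eucl N → ℝ} (h : MemZ κ Ω σ) :
    ∃ S : ℝ, 0 ≤ S ∧ ∀ x ∈ Ω, σ x ≤ S := by
  obtain ⟨C, s, hC0, -, -, hC⟩ := h.exists_measurable hκ
  rcases Ω.eq_empty_or_nonempty with rfl | ⟨y, hy⟩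
  · exact ⟨0, le_rfl, by simp⟩
  refine ⟨C * (σ y + diam Ω ^ κ), ?_, fun x hx => (hC x hx y hy).trans ?_⟩
  · have := h.1 y hy
    have := diam_nonneg (s := Ω)
    positivity
  · gcongr
    rw [← dist_eq_norm]
    exact dist_le_diam_of_mem hb hx hy

/-- The pointwise estimate behind the absence of the gap. Either `σ x` is at most of order `r ^ ϰ`,
and the surplus power `S ^ (q - p)` is absorbed by that factor, or `σ x` is comparable to `σ` on
the whole ball `ball x r`, and may be moved inside the average. -/
theorem weight_mul_rpow_le {N : ℕ} {κ p q : ℝ} (hp : 0 ≤ p) (hpq : p ≤ q) (hq : 0 < q)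
    (hκ : 0 < κ)
    {Ω : Set (Eucl N)} {σ s : Eucl N → ℝ} {C : ℝ} (hC : 0 < C)
    (hs : ∀ x ∈ Ω, s x ≤ σ x ∧ σ x ≤ C * s x)
    (hσ : ∀ x ∈ Ω, ∀ y ∈ Ω, σ x ≤ C * (σ y + ‖x - y‖ ^ κ)) {x : Eucl N} (hx : x ∈ Ω) {r : ℝ}
    {S c B : ℝ≥0∞} {f : Eucl N → ℝ≥0∞} (hf : ∀ y ∉ Ω, f y = 0)
    (hS : S ≤ c * ∫⁻ y in ball x r, f y) (hB : ENNReal.ofReal (r ^ κ) * S ^ (q - p) ≤ B) :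
    ENNReal.ofReal (σ x) * S ^ q ≤ ENNReal.ofReal (2 * C) * B * S ^ p +
      ENNReal.ofReal (2 * C * C) *
        (c * ∫⁻ y in ball x r, ENNReal.ofReal (s y) ^ (1 / q) * f y) ^ q := by
  have hroot : ∀ z : ℝ≥0∞, (z ^ (1 / q)) ^ q = z := fun z => by
    rw [← ENNReal.rpow_mul, one_div_mul_cancel hq.ne', ENNReal.rpow_one]
  rcases le_or_gt (σ x) (2 * C * r ^ κ) with hle | hlt
  · refine le_add_right ?_
    have hS' : S ^ q = S ^ (q - p) * S ^ p := by
      rw [← ENNReal.rpow_add_of_nonneg _ _ (by linarith) hp]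
      simp
    calc ENNReal.ofReal (σ x) * S ^ q
        ≤ ENNReal.ofReal (2 * C * r ^ κ) * (S ^ (q - p) * S ^ p) := by
          rw [hS']; gcongr
      _ = ENNReal.ofReal (2 * C) * (ENNReal.ofReal (r ^ κ) * S ^ (q - p)) * S ^ p := by
          rw [ENNReal.ofReal_mul (by positivity)]; ring
      _ ≤ _ := by gcongr
  · refine le_add_left ?_
    have hcomp : ∀ y ∈ ball x r, y ∈ Ω → σ x ≤ 2 * C * C * s y := by
      intro y hy hyΩ
      have h1 := hσ x hx y hyΩ
      have h2 : ‖x - y‖ ^ κ ≤ r ^ κ := by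
        gcongr
        exact (mem_ball_iff_norm'.1 hy).le
      have h3 : C * ‖x - y‖ ^ κ ≤ C * r ^ κ := by gcongr
      have h4 : C * σ y ≤ C * (C * s y) := mul_le_mul_of_nonneg_left (hs y hyΩ).2 hC.le
      linarith [mul_add C (σ y) (‖x - y‖ ^ κ)]
    calc ENNReal.ofReal (σ x) * S ^ q
        ≤ ENNReal.ofReal (σ x) * (c * ∫⁻ y in ball x r, f y) ^ q := by gcongr
      _ = (c * (ENNReal.ofReal (σ x) ^ (1 / q) * ∫⁻ y in ball x r, f y)) ^ q := by
          nth_rewrite 1 [← hroot (ENNReal.ofReal (σ x))]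
          rw [← ENNReal.mul_rpow_of_nonneg _ _ hq.le]
          congr 1
          ring
      _ ≤ (c * (ENNReal.ofReal (2 * C * C) ^ (1 / q) *
            ∫⁻ y in ball x r, ENNReal.ofReal (s y) ^ (1 / q) * f y)) ^ q := by
          gcongr ?_ ^ q
          gcongr c * ?_
          rw [← lintegral_const_mul' _ _ (ENNReal.rpow_ne_top_of_nonneg (by positivity)
            ENNReal.ofReal_ne_top), ← lintegral_const_mul' _ _ (ENNReal.rpow_ne_top_of_nonneg
            (by positivity) ENNReal.ofReal_ne_top)]
          refine setLIntegral_mono' measurableSet_ball fun y hy => ?_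
          by_cases hyΩ : y ∈ Ω
          · rw [← mul_assoc]
            gcongr
            rw [← ENNReal.mul_rpow_of_nonneg _ _ (by positivity),
              ← ENNReal.ofReal_mul (by positivity)]
            gcongr
            exact hcomp y hy hyΩ
          · simp [hf y hyΩ]
      _ = _ := by
          rw [mul_left_comm, ENNReal.mul_rpow_of_nonneg _ _ hq.le, hroot]

/-! ### Uniform integrability of averages -/

/-- Convergence of integrals of functions that tend to zero almost everywhere and are dominated by
an integrable function up to errors that are small in mean. -/
theorem tendsto_lintegral_zero_of_le_add {α : Type*} [MeasurableSpace α] {μ : Measure α}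
    {g : ℕ → α → ℝ≥0∞} (hg : ∀ n, AEMeasurable (g n) μ)
    (hlim : ∀ᵐ x ∂μ, Filter.Tendsto (fun n => g n x) Filter.atTop (nhds 0))
    (h : ∀ η : ℝ≥0∞, 0 < η → ∃ (F : α → ℝ≥0∞) (e : ℕ → α → ℝ≥0∞), AEMeasurable F μ ∧
      ∫⁻ x, F x ∂μ ≠ ∞ ∧ ∀ᶠ n in Filter.atTop, (∀ᵐ x ∂μ, g n x ≤ F x + e n x) ∧
        ∫⁻ x, e n x ∂μ ≤ η) :
    Filter.Tendsto (fun n => ∫⁻ x, g n x ∂μ) Filter.atTop (nhds 0) := by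
  rw [ENNReal.tendsto_nhds_zero]
  intro ε hε
  have hε2 : 0 < ε / 2 := ENNReal.half_pos hε.ne'
  obtain ⟨F, e, hF, hFi, hev⟩ := h (ε / 2) hε2
  have hmin : Filter.Tendsto (fun n => ∫⁻ x, min (g n x) (F x) ∂μ) Filter.atTop
      (nhds (∫⁻ _, 0 ∂μ)) := by
    refine tendsto_lintegral_of_dominated_convergence' F (fun n => (hg n).min hF)
      (fun n => Filter.Eventually.of_forall fun x => min_le_right _ _) hFi ?_
    filter_upwards [hlim] with x hx
    exact tendsto_of_tendsto_of_tendsto_of_le_of_le tendsto_const_nhds hx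
      (fun n => zero_le) fun n => min_le_left _ _
  rw [lintegral_zero, ENNReal.tendsto_nhds_zero] at hmin
  filter_upwards [hev, hmin (ε / 2) hε2] with n hn hn2
  calc ∫⁻ x, g n x ∂μ ≤ ∫⁻ x, (min (g n x) (F x) + e n x) ∂μ := by
        refine lintegral_mono_ae ?_
        filter_upwards [hn.1] with x hx
        rcases le_total (g n x) (F x) with h1 | h1
        · rw [min_eq_left h1]; exact le_self_add
        · rwa [min_eq_right h1]
    _ = ∫⁻ x, min (g n x) (F x) ∂μ + ∫⁻ x, e n x ∂μ := lintegral_add_left' ((hg n).min hF) _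
    _ ≤ ε / 2 + ε / 2 := add_le_add hn2 hn.2
    _ = ε := ENNReal.add_halves ε

theorem exists_lintegral_tail_le {α : Type*} [MeasurableSpace α] {μ : Measure α} {q : ℝ}
    (hq : 0 < q) {W h : α → ℝ≥0∞} (hW : Measurable W) (hh : Measurable h) (hht : ∀ x, h x ≠ ∞)
    (hfin : ∫⁻ x, W x * h x ^ q ∂μ ≠ ∞) {η : ℝ≥0∞} (hη : 0 < η) :
    ∃ m : ℕ, ∫⁻ x, W x * ({x | (m : ℝ≥0∞) < h x}.indicator h x) ^ q ∂μ ≤ η := by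
  have hms : ∀ m : ℕ, MeasurableSet {x | (m : ℝ≥0∞) < h x} := fun m =>
    measurableSet_lt measurable_const hh
  have hlim : Filter.Tendsto (fun m : ℕ => ∫⁻ x, W x * ({x | (m : ℝ≥0∞) < h x}.indicator h x) ^ q
      ∂μ) Filter.atTop (nhds (∫⁻ _, 0 ∂μ)) := by
    refine tendsto_lintegral_of_dominated_convergence' (fun x => W x * h x ^ q)
      (fun m => (hW.mul ((hh.indicator (hms m)).pow_const q)).aemeasurable)
      (fun m => Filter.Eventually.of_forall fun x => ?_) hfin
      (Filter.Eventually.of_forall fun x => ?_)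
    · dsimp only
      gcongr
      exact indicator_le_self _ _ x
    · obtain ⟨m₀, hm₀⟩ := ENNReal.exists_nat_gt (hht x)
      refine tendsto_const_nhds.congr' ?_
      filter_upwards [Filter.eventually_ge_atTop m₀] with m hm
      have : x ∉ {x | (m : ℝ≥0∞) < h x} := by
        simp only [mem_ofPred_eq, not_lt]
        exact hm₀.le.trans (by exact_mod_cast hm)
      rw [indicator_of_notMem this, ENNReal.zero_rpow_of_pos hq, mul_zero]
  rw [lintegral_zero, ENNReal.tendsto_nhds_zero] at hlim
  exact (hlim η hη).exists

/-- Averages of a function in `L^q(W)` are uniformly integrable: up to an error that is small in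
mean, uniformly in the scale, they are bounded. -/
theorem exists_average_le_const_add {N : ℕ} {Ω : Set (Eucl N)} {q : ℝ}
    (hq : 1 ≤ q) {W h : Eucl N → ℝ≥0∞} (hW : Measurable W) (hh : Measurable h)
    (hht : ∀ x, h x ≠ ∞) (hh0 : ∀ x ∉ Ω, h x = 0) (hfin : ∫⁻ x in Ω, W x * h x ^ q ≠ ∞)
    {r : ℕ → ℝ} {c : ℕ → ℝ≥0∞} {D L : ℝ≥0∞} (hD : D ≠ ∞) (hL : L ≠ ∞) {n₀ : ℕ}
    (hc : ∀ n ≥ n₀, c n * volume (ball (0 : Eucl N) (r n)) ≤ D)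
    (hbd : ∀ n ≥ n₀, ∀ g : Eucl N → ℝ≥0∞, Measurable g → (∀ x ∉ Ω, g x = 0) →
      ∫⁻ x in Ω, W x * (c n * ∫⁻ y in ball x (r n), g y) ^ q ≤ L * ∫⁻ x in Ω, W x * g x ^ q)
    {η : ℝ≥0∞} (hη : 0 < η) :
    ∃ (M : ℝ≥0∞) (e : ℕ → Eucl N → ℝ≥0∞), M ≠ ∞ ∧ (∀ n, Measurable (e n)) ∧ ∀ n ≥ n₀,
      (∀ x, W x * (c n * ∫⁻ y in ball x (r n), h y) ^ q ≤ M * W x + e n x) ∧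
        ∫⁻ x in Ω, e n x ≤ η := by
  have hq0 : 0 < q := by linarith
  set T : ℝ≥0∞ := 2 ^ (q - 1) with hT
  have hTt : T ≠ ∞ := ENNReal.rpow_ne_top_of_nonneg (by linarith) ENNReal.ofNat_ne_top
  obtain ⟨η', hη', hη'T⟩ : ∃ η' : ℝ≥0∞, 0 < η' ∧ T * (L * η') ≤ η := by
    obtain ⟨η', hη', hlt⟩ := exists_pos_mul_add_lt (ENNReal.mul_ne_top hTt hL) hη
    obtain ⟨η'', h1, h2⟩ := exists_between hη'
    refine ⟨η'', h1, ?_⟩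
    have := hlt η'' 0 h2 hη'
    rw [add_zero, mul_assoc] at this
    exact this.le
  obtain ⟨m, hm⟩ := exists_lintegral_tail_le hq0 hW hh hht hfin hη'
  set g : Eucl N → ℝ≥0∞ := {x | (m : ℝ≥0∞) < h x}.indicator h with hg
  have mg : Measurable g := hh.indicator (measurableSet_lt measurable_const hh)
  have hg0 : ∀ x ∉ Ω, g x = 0 := fun x hx =>
    le_antisymm ((indicator_le_self _ _ x).trans (hh0 x hx).le) zero_le
  have hle : ∀ y, h y ≤ m + g y := fun y => by
    by_cases hy : (m : ℝ≥0∞) < h y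
    · have : g y = h y := indicator_of_mem (by exact hy) h
      rw [this]; exact le_add_self
    · exact (not_lt.1 hy).trans le_self_add
  have me : ∀ n, Measurable fun x => c n * ∫⁻ y in ball x (r n), g y := fun n =>
    (measurable_lintegral_ball _ mg).const_mul _
  refine ⟨T * (D * m) ^ q, fun n x => T * (W x * (c n * ∫⁻ y in ball x (r n), g y) ^ q),
    ENNReal.mul_ne_top hTt (ENNReal.rpow_ne_top_of_nonneg hq0.le
      (ENNReal.mul_ne_top hD (ENNReal.natCast_ne_top m))),
    fun n => (hW.mul ((me n).pow_const q)).const_mul _, fun n hn => ⟨fun x => ?_, ?_⟩⟩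
  · calc W x * (c n * ∫⁻ y in ball x (r n), h y) ^ q
        ≤ W x * (D * m + c n * ∫⁻ y in ball x (r n), g y) ^ q := by
          gcongr
          calc c n * ∫⁻ y in ball x (r n), h y
              ≤ c n * ∫⁻ y in ball x (r n), (m + g y) := by
                gcongr with y
                exact hle y
            _ = c n * volume (ball (0 : Eucl N) (r n)) * m + c n * ∫⁻ y in ball x (r n), g y := by
                rw [lintegral_add_left measurable_const, lintegral_const,
                  Measure.restrict_apply_univ, volume_ball_eq, mul_add]
                ring
            _ ≤ _ := by
                gcongr
                exact hc n hn
      _ ≤ W x * (T * ((D * m) ^ q + (c n * ∫⁻ y in ball x (r n), g y) ^ q)) := by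
          gcongr
          exact ENNReal.rpow_add_le_mul_rpow_add_rpow _ _ hq
      _ = _ := by ring
  · rw [lintegral_const_mul' _ _ hTt]
    calc _ ≤ T * (L * ∫⁻ x in Ω, W x * g x ^ q) := by
          gcongr
          exact hbd n hn g mg hg0
      _ ≤ T * (L * η') := by gcongr
      _ ≤ η := hη'T

/-! ### Energy convergence of mollifications -/

theorem rpow_mul_rpow_le_of_le {d S Q : ℝ≥0∞} (hd : d ≤ 1) {m n β κ γ : ℝ} (hβ : 0 ≤ β)
    (hm : m * β = γ) (hn : n * β ≤ κ) (h : S ^ m * d ^ n ≤ Q) : d ^ κ * S ^ γ ≤ Q ^ β := by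
  calc d ^ κ * S ^ γ ≤ d ^ (n * β) * S ^ (m * β) := by
        rw [hm]
        gcongr ?_ * _
        exact ENNReal.rpow_le_rpow_of_exponent_ge hd hn
    _ = (S ^ m * d ^ n) ^ β := by
        rw [ENNReal.mul_rpow_of_nonneg _ _ hβ, ← ENNReal.rpow_mul, ← ENNReal.rpow_mul, mul_comm]
    _ ≤ Q ^ β := by gcongr

theorem ofReal_mul_inv_pow_mul_volume_ball {N : ℕ} (hN : 1 ≤ N) {C : ℝ} (hC : 0 ≤ C) (R : ℝ)
    {δ : ℝ} (hδ : 0 < δ) : ENNReal.ofReal (C * (δ⁻¹) ^ N) * volume (ball (0 : Eucl N) (R * δ)) =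
      ENNReal.ofReal C * volume (ball (0 : Eucl N) R) := by
  rw [volume_ball_mul hN R hδ.le, ← mul_assoc, ← ENNReal.ofReal_mul (by positivity), mul_assoc,
    inv_pow, inv_mul_cancel₀ (by positivity), mul_one]

/-- At scale `δ` the gradient of a mollification is at most of order `δ⁻¹`, because `w` is
bounded, and at most of order `δ ^ (-N / p)`, because `H ∈ L^p`. Under the bound on `q` one of the
two makes `δ ^ ϰ |∇|^(q - p)` bounded. -/
theorem IsMollifier.exists_rpow_mul_gradient_le {N : ℕ} (hN : 1 ≤ N) {p q κ : ℝ} (hp : 1 ≤ p)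
    (hpq : p ≤ q) (hq : q ≤ p + κ * max 1 (p / N)) {k w : Eucl N → ℝ} {R M : ℝ} (hR : 0 < R)
    (hk : IsMollifier k R) {H : Eucl N → Eucl N} (hw : IsWeakGradient univ w H)
    (hM : ∀ x, |w x| ≤ M) (hHm : Measurable H) (hH : ∫⁻ x, ‖H x‖ₑ ^ p ≠ ∞) :
    ∃ B : ℝ≥0∞, B ≠ ∞ ∧ ∀ δ : ℝ, 0 < δ → δ ≤ 1 → ∀ x,
      ENNReal.ofReal ((R * δ) ^ κ) * ‖gradient (mollify (_root_.rescale k δ) w) x‖ₑ ^ (q - p) ≤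
        B := by
  have l1 : LocallyIntegrable w := locallyIntegrableOn_univ.1 hw.1
  have hN0 : (0 : ℝ) < N := by exact_mod_cast hN
  suffices h : ∃ B : ℝ≥0∞, B ≠ ∞ ∧ ∀ δ : ℝ, 0 < δ → δ ≤ 1 → ∀ x,
      ENNReal.ofReal δ ^ κ * ‖gradient (mollify (_root_.rescale k δ) w) x‖ₑ ^ (q - p) ≤ B by
    obtain ⟨B, hB, h⟩ := h
    refine ⟨ENNReal.ofReal (R ^ κ) * B, ENNReal.mul_ne_top ENNReal.ofReal_ne_top hB,
      fun δ hδ hδ1 x => ?_⟩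
    rw [Real.mul_rpow hR.le hδ.le, ENNReal.ofReal_mul (by positivity),
      ← ENNReal.ofReal_rpow_of_pos hδ, mul_assoc]
    gcongr
    exact h δ hδ hδ1 x
  rcases le_total (p / N) 1 with hc | hc
  · obtain ⟨C, hC0, hC⟩ := hk.exists_norm_gradient_mollify_le_div
    rw [max_eq_left hc, mul_one] at hq
    refine ⟨ENNReal.ofReal (C * M) ^ (q - p), ENNReal.rpow_ne_top_of_nonneg (by linarith)
      ENNReal.ofReal_ne_top, fun δ hδ hδ1 x => ?_⟩
    refine rpow_mul_rpow_le_of_le (m := 1) (n := 1) (ENNReal.ofReal_le_one.2 hδ1) (by linarith)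
      (by ring) (by linarith) ?_
    rw [ENNReal.rpow_one, ENNReal.rpow_one, ← ofReal_norm, ← ENNReal.ofReal_mul (norm_nonneg _)]
    refine ENNReal.ofReal_le_ofReal ?_
    rw [← le_div_iff₀ hδ, div_eq_mul_inv]
    exact hC w M δ l1 hM hδ x
  · obtain ⟨C, hC0, hC⟩ := hk.exists_le
    rw [max_eq_right hc] at hq
    have hp0 : 0 < p := by linarith
    have hp1 : 0 ≤ p - 1 := by linarith
    set V := volume (ball (0 : Eucl N) R) with hV
    have hVt : V ≠ ∞ := measure_ball_lt_top.ne
    set Q : ℝ≥0∞ := (ENNReal.ofReal C * V) ^ (p - 1) * ENNReal.ofReal C * ∫⁻ x, ‖H x‖ₑ ^ p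
    have hQ : Q ≠ ∞ := ENNReal.mul_ne_top (ENNReal.mul_ne_top (ENNReal.rpow_ne_top_of_nonneg hp1
      (ENNReal.mul_ne_top ENNReal.ofReal_ne_top hVt)) ENNReal.ofReal_ne_top) hH
    refine ⟨Q ^ ((q - p) / p), ENNReal.rpow_ne_top_of_nonneg
      (div_nonneg (by linarith) hp0.le) hQ, fun δ hδ hδ1 x => ?_⟩
    refine rpow_mul_rpow_le_of_le (m := p) (n := N) (ENNReal.ofReal_le_one.2 hδ1)
      (div_nonneg (by linarith) hp0.le) (by field_simp) ?_ ?_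
    · rw [← mul_div_assoc, div_le_iff₀ hp0]
      have : κ * (p / N) * N = κ * p := by field_simp
      nlinarith
    set c := ENNReal.ofReal (C * (δ⁻¹) ^ N) with hcdef
    have hcV : c * volume (ball (0 : Eucl N) (R * δ)) = ENNReal.ofReal C * V :=
      ofReal_mul_inv_pow_mul_volume_ball hN hC0 R hδ
    have hcd : c * ENNReal.ofReal δ ^ (N : ℝ) = ENNReal.ofReal C := by
      rw [ENNReal.rpow_natCast, ← ENNReal.ofReal_pow hδ.le, hcdef,
        ← ENNReal.ofReal_mul (by positivity), mul_assoc, inv_pow, inv_mul_cancel₀ (by positivity),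
        mul_one]
    calc ‖gradient (mollify (_root_.rescale k δ) w) x‖ₑ ^ p * ENNReal.ofReal δ ^ (N : ℝ)
        ≤ (c * ∫⁻ y in ball x (R * δ), ‖H y‖ₑ) ^ p * ENNReal.ofReal δ ^ (N : ℝ) := by
          gcongr
          exact hk.enorm_gradient_mollify_le hC hw hδ x
      _ ≤ (c ^ p * (volume (ball (0 : Eucl N) (R * δ)) ^ (p - 1) * ∫⁻ y, ‖H y‖ₑ ^ p)) *
            ENNReal.ofReal δ ^ (N : ℝ) := by
          rw [ENNReal.mul_rpow_of_nonneg _ _ hp0.le]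
          gcongr
          have := rpow_lintegral_le_measure_univ (μ := volume.restrict (ball x (R * δ))) hp
            hHm.enorm
          rw [Measure.restrict_apply_univ, volume_ball_eq] at this
          refine this.trans ?_
          gcongr
          exact Measure.restrict_le_self
      _ = (c * volume (ball (0 : Eucl N) (R * δ))) ^ (p - 1) *
            (c * ENNReal.ofReal δ ^ (N : ℝ)) * ∫⁻ y, ‖H y‖ₑ ^ p := by
          have : c ^ p = c ^ (p - 1) * c := by
            nth_rewrite 3 [← ENNReal.rpow_one c]
            rw [← ENNReal.rpow_add_of_nonneg _ _ hp1 zero_le_one]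
            simp
          rw [this, ENNReal.mul_rpow_of_nonneg _ _ hp1]
          ring
      _ = Q := by rw [hcV, hcd]

/-- Approximation of a bounded function that is supported where `Ω` can be pushed into itself:
mollification with a translated kernel converges in energy. -/
theorem approxByTest_of_push {N : ℕ} (hN : 1 ≤ N) {Ω U : Set (Eucl N)} (hΩ : IsOpen Ω)
    (hΩb : Bornology.IsBounded Ω) {p q κ : ℝ} (hp : 1 ≤ p) (hpq : p ≤ q) (hq1 : 1 < q)
    (hκ : 0 < κ) (hq : q ≤ p + κ * max 1 (p / N)) {a σ s : Eucl N → ℝ}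
    (ha : AEMeasurable a (volume.restrict Ω)) {C : ℝ} (hC : 0 < C) (hsm : Measurable s)
    (hs : ∀ x ∈ Ω, s x ≤ σ x ∧ σ x ≤ C * s x)
    (hσ : ∀ x ∈ Ω, ∀ y ∈ Ω, σ x ≤ C * (σ y + ‖x - y‖ ^ κ))
    {W : Eucl N → ℝ≥0∞} {K : ℝ≥0} (hW : Measurable W) (hWt : ∀ x, W x ≠ ∞)
    (hK : MuckenhouptBound q U K W)
    (haW : ∀ᵐ x ∂volume.restrict Ω, ENNReal.ofReal (a x) = ENNReal.ofReal (σ x) * W x)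
    {B : ℝ≥0} (hWB : ∀ᵐ x ∂volume.restrict Ω, W x ≤ B)
    {ρ₀ : ℝ} (hρ₀ : 0 < ρ₀) (hΩU : ∀ y ∈ Ω, ball y ρ₀ ⊆ U)
    {w : Eucl N → ℝ} {H : Eucl N → Eucl N} {M : ℝ} (hw : IsWeakGradient univ w H)
    (hM : ∀ x, |w x| ≤ M) {S : Set (Eucl N)} (hSΩ : S ⊆ Ω) (hw0 : ∀ x ∉ S, w x = 0)
    (hHm : Measurable H) (hH0 : ∀ x ∉ Ω, H x = 0) {e : Eucl N} {c t₀ : ℝ} (hc : 0 < c)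
    (ht₀ : 0 < t₀) (hpush : ∀ y ∈ S, ∀ t, 0 < t → t < t₀ → closedBall (y + t • e) (c * t) ⊆ Ω)
    (hfin : dpEnergy Ω a p q H < ∞) : ApproxByTest Ω a p q H := by
  have l1 : LocallyIntegrable w := locallyIntegrableOn_univ.1 hw.1
  have hp0 : 0 < p := by linarith
  have hq0 : 0 < q := by linarith
  obtain ⟨k, hk, hkc⟩ := exists_isMollifier e (half_pos hc)
  set R := ‖e‖ + 2 * (c / 2) with hRdef
  have hR : 0 < R := by positivity
  obtain ⟨Ck, hCk0, hCk⟩ := hk.exists_le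
  set δ : ℕ → ℝ := fun n => ((n : ℝ) + 1)⁻¹ with hδ
  have hδ0 : ∀ n, 0 < δ n := fun n => by positivity
  have hδ1 : ∀ n, δ n ≤ 1 := fun n => inv_le_one_of_one_le₀ (by linarith [n.cast_nonneg (α := ℝ)])
  have hδlim : Filter.Tendsto δ Filter.atTop (nhds 0) := by
    simpa [hδ] using tendsto_one_div_add_atTop_nhds_zero_nat (𝕜 := ℝ)
  obtain ⟨n₀, hn₀⟩ : ∃ n₀, ∀ n ≥ n₀, δ n < t₀ ∧ δ n < ρ₀ / (2 * R) :=
    Filter.eventually_atTop.1 ((hδlim.eventually (gt_mem_nhds ht₀)).and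
      (hδlim.eventually (gt_mem_nhds (by positivity))))
  set φ : ℕ → Eucl N → ℝ := fun n => mollify (rescale k (δ n)) w with hφ
  have hφT : ∀ n ≥ n₀, IsTestFunction Ω (φ n) := fun n hn =>
    hk.isTestFunction_mollify hkc l1 (hΩb.subset hSΩ) hw0 hc (hδ0 n)
      fun y hy => hpush y hy (δ n) (hδ0 n) (hn₀ n hn).1
  have hφg : ∀ n, Continuous (gradient (φ n)) := fun n =>
    (((hk.rescale (hδ0 n)).contDiff_mollify l1).of_le
      (by exact_mod_cast le_top)).continuous_gradient
  suffices hmain : Filter.Tendsto (fun n => dpEnergy Ω a p q (H - gradient (φ n))) Filter.atTop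
      (nhds 0) by
    intro ε hε
    obtain ⟨n, h1, h2⟩ := ((hmain.eventually (gt_mem_nhds hε)).and
      (Filter.eventually_ge_atTop n₀)).exists
    exact ⟨φ n, hφT n h2, h1⟩
  -- the two integrable majorants: `|H|` in `L^p` and `f = s^(1/q) |H|` in `L^q(W)`
  set f : Eucl N → ℝ≥0∞ := fun y => ENNReal.ofReal (s y) ^ (1 / q) * ‖H y‖ₑ with hf
  have mf : Measurable f := (hsm.ennreal_ofReal.pow_const _).mul hHm.enorm
  have hft : ∀ x, f x ≠ ∞ := fun x => ENNReal.mul_ne_top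
    (ENNReal.rpow_ne_top_of_nonneg (by positivity) ENNReal.ofReal_ne_top) enorm_ne_top
  have hHe0 : ∀ x ∉ Ω, ‖H x‖ₑ = 0 := fun x hx => by rw [hH0 x hx, enorm_zero]
  have hf0 : ∀ x ∉ Ω, f x = 0 := fun x hx => by simp only [hf, hHe0 x hx, mul_zero]
  have hext : ∀ (r : ℝ) (_ : 0 < r) (g : Eucl N → ℝ≥0∞), (∀ x ∉ Ω, g x = 0) →
      ∫⁻ x, g x ^ r = ∫⁻ x in Ω, g x ^ r := by
    intro r hr g hg
    refine (setLIntegral_eq_of_support_subset ?_).symm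
    intro x hx
    by_contra hxΩ
    exact hx (by simp only [hg x hxΩ, ENNReal.zero_rpow_of_pos hr])
  have hHp : ∫⁻ x in Ω, ‖H x‖ₑ ^ p ≠ ∞ :=
    ((lintegral_mono fun x => le_self_add).trans_lt hfin).ne
  have hHp' : ∫⁻ x, ‖H x‖ₑ ^ p ≠ ∞ := by rwa [hext p hp0 _ hHe0]
  have hfq : ∫⁻ x in Ω, W x * f x ^ q ≠ ∞ := by
    refine ne_of_lt (lt_of_le_of_lt (lintegral_mono_ae ?_) hfin)
    filter_upwards [haW, ae_restrict_mem hΩ.measurableSet] with x hx hxΩ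
    refine le_add_left ?_
    rw [hx, hf, ENNReal.mul_rpow_of_nonneg _ _ hq0.le, ← ENNReal.rpow_mul,
      one_div_mul_cancel hq0.ne', ENNReal.rpow_one, ← mul_assoc, mul_comm (W x)]
    gcongr
    exact (hs x hxΩ).1
  -- averages at scale `δ n` are bounded uniformly in `n` on both spaces
  set cn : ℕ → ℝ≥0∞ := fun n => ENNReal.ofReal (Ck * ((δ n)⁻¹) ^ N) with hcn
  have hcnt : ∀ n, cn n ≠ ∞ := fun n => ENNReal.ofReal_ne_top
  set D : ℝ≥0∞ := ENNReal.ofReal Ck * volume (ball (0 : Eucl N) R) with hD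
  have hDt : D ≠ ∞ := ENNReal.mul_ne_top ENNReal.ofReal_ne_top measure_ball_lt_top.ne
  set D₂ : ℝ≥0∞ := ENNReal.ofReal Ck * volume (ball (0 : Eucl N) (2 * R)) with hD₂
  have hD₂t : D₂ ≠ ∞ := ENNReal.mul_ne_top ENNReal.ofReal_ne_top measure_ball_lt_top.ne
  have hcD : ∀ n, cn n * volume (ball (0 : Eucl N) (R * δ n)) = D := fun n =>
    ofReal_mul_inv_pow_mul_volume_ball hN hCk0 R (hδ0 n)
  have hcD₂ : ∀ n, cn n * volume (ball (0 : Eucl N) (2 * (R * δ n))) = D₂ := fun n => by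
    rw [← mul_assoc 2 R]
    exact ofReal_mul_inv_pow_mul_volume_ball hN hCk0 (2 * R) (hδ0 n)
  have hbdp : ∀ n ≥ n₀, ∀ g : Eucl N → ℝ≥0∞, Measurable g → (∀ x ∉ Ω, g x = 0) →
      ∫⁻ x in Ω, (fun _ => (1 : ℝ≥0∞)) x * (cn n * ∫⁻ y in ball x (R * δ n), g y) ^ p ≤
        D ^ p * ∫⁻ x in Ω, (fun _ => (1 : ℝ≥0∞)) x * g x ^ p := by
    intro n _ g hg hg0
    simp only [one_mul, ENNReal.mul_rpow_of_nonneg _ _ hp0.le]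
    rw [lintegral_const_mul' _ _ (ENNReal.rpow_ne_top_of_nonneg hp0.le (hcnt n)), ← hcD n,
      ENNReal.mul_rpow_of_nonneg _ _ hp0.le, mul_assoc]
    gcongr
    rw [← hext p hp0 g hg0]
    exact (setLIntegral_le_lintegral _ _).trans (lintegral_rpow_lintegral_ball_le _ hp hg)
  have hbdq : ∀ n ≥ n₀, ∀ g : Eucl N → ℝ≥0∞, Measurable g → (∀ x ∉ Ω, g x = 0) →
      ∫⁻ x in Ω, W x * (cn n * ∫⁻ y in ball x (R * δ n), g y) ^ q ≤
        (K * D₂ ^ q) * ∫⁻ x in Ω, W x * g x ^ q := by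
    intro n hn g hg hg0
    have hsub : ∀ y ∈ Ω, ball y (2 * (R * δ n)) ⊆ U := fun y hy => by
      refine (ball_subset_ball ?_).trans (hΩU y hy)
      have := (hn₀ n hn).2
      rw [lt_div_iff₀ (by positivity)] at this
      linarith
    have h1 := lintegral_weight_mul_rpow_lintegral_ball_le (mul_pos hR (hδ0 n)) hq1
      hΩ.measurableSet hsub hW hWt hK hg hg0
    simp only [ENNReal.mul_rpow_of_nonneg _ _ hq0.le, mul_left_comm (W _)]
    rw [lintegral_const_mul' _ _ (ENNReal.rpow_ne_top_of_nonneg hq0.le (hcnt n)), ← hcD₂ n,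
      ENNReal.mul_rpow_of_nonneg _ _ hq0.le]
    calc _ ≤ cn n ^ q * (K * volume (ball (0 : Eucl N) (2 * (R * δ n))) ^ q *
          ∫⁻ x in Ω, W x * g x ^ q) := by gcongr
      _ = _ := by ring
  obtain ⟨Bb, hBb, hBbd⟩ := hk.exists_rpow_mul_gradient_le hN hp hpq hq hR hw hM hHm hHp'
  set k₁ : ℝ≥0∞ := 1 + B * (ENNReal.ofReal (2 * C) * Bb) with hk₁
  set k₂ : ℝ≥0∞ := ENNReal.ofReal (2 * C * C) with hk₂
  have hk₁t : k₁ ≠ ∞ := ENNReal.add_ne_top.2 ⟨ENNReal.one_ne_top, ENNReal.mul_ne_top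
    ENNReal.coe_ne_top (ENNReal.mul_ne_top ENNReal.ofReal_ne_top hBb)⟩
  have hk₂t : k₂ ≠ ∞ := ENNReal.ofReal_ne_top
  set c₀ : ℝ≥0∞ := (2⁻¹ : ℝ≥0∞) ^ (1 - q) with hc₀
  have hc₀t : c₀ ≠ ∞ := two_inv_rpow_ne_top _
  -- the energy density of `∇(φ n)` is controlled by the averages of the majorants
  have hpt : ∀ n, ∀ᵐ x ∂volume.restrict Ω,
      ‖gradient (φ n) x‖ₑ ^ p + ENNReal.ofReal (a x) * ‖gradient (φ n) x‖ₑ ^ q ≤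
        k₁ * (cn n * ∫⁻ y in ball x (R * δ n), ‖H y‖ₑ) ^ p +
          k₂ * (W x * (cn n * ∫⁻ y in ball x (R * δ n), f y) ^ q) := by
    intro n
    filter_upwards [haW, hWB, ae_restrict_mem hΩ.measurableSet] with x hx hxB hxΩ
    have hSx := hk.enorm_gradient_mollify_le hCk hw (hδ0 n) x
    have h1 := weight_mul_rpow_le hp0.le hpq hq0 hκ hC hs hσ hxΩ hHe0 hSx
      (hBbd (δ n) (hδ0 n) (hδ1 n) x)
    set T := ‖gradient (φ n) x‖ₑ with hT
    change ENNReal.ofReal (σ x) * T ^ q ≤ ENNReal.ofReal (2 * C) * Bb * T ^ p +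
      k₂ * (cn n * ∫⁻ y in ball x (R * δ n), f y) ^ q at h1
    change T ≤ cn n * ∫⁻ y in ball x (R * δ n), ‖H y‖ₑ at hSx
    calc T ^ p + ENNReal.ofReal (a x) * T ^ q
        = T ^ p + W x * (ENNReal.ofReal (σ x) * T ^ q) := by rw [hx]; ring
      _ ≤ T ^ p + W x * (ENNReal.ofReal (2 * C) * Bb * T ^ p +
            k₂ * (cn n * ∫⁻ y in ball x (R * δ n), f y) ^ q) := by gcongr
      _ = (1 + W x * (ENNReal.ofReal (2 * C) * Bb)) * T ^ p +
            k₂ * (W x * (cn n * ∫⁻ y in ball x (R * δ n), f y) ^ q) := by ring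
      _ ≤ _ := by
          rw [hk₁]
          gcongr
  refine tendsto_lintegral_zero_of_le_add (fun n => AEMeasurable.dpEnergy_integrand p q ha
    (hHm.aestronglyMeasurable.sub (hφg n).aestronglyMeasurable)) ?_ fun η hη => ?_
  · filter_upwards [ae_restrict_of_ae (hk.ae_tendsto_gradient_mollify hR hw)] with x hx
    refine tendsto_dpIntegrand_zero hp0 hq0 (a x) ?_
    have := (tendsto_const_nhds (x := H x)).sub hx
    rw [sub_self] at this
    exact this
  obtain ⟨η', hη', hlt⟩ := exists_pos_mul_add_lt
    (ENNReal.mul_ne_top hc₀t (ENNReal.add_ne_top.2 ⟨hk₁t, hk₂t⟩)) hη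
  obtain ⟨η'', hη''0, hη''⟩ := exists_between hη'
  obtain ⟨M₁, e₁, hM₁, me₁, h₁⟩ := exists_average_le_const_add hp (W := fun _ => 1)
    measurable_const hHm.enorm (fun x => enorm_ne_top) hHe0 (by simpa using hHp) hDt
    (ENNReal.rpow_ne_top_of_nonneg hp0.le hDt) (n₀ := n₀) (fun n _ => (hcD n).le) hbdp hη''0
  obtain ⟨M₂, e₂, hM₂, me₂, h₂⟩ := exists_average_le_const_add hq1.le hW mf hft hf0 hfq hDt
    (ENNReal.mul_ne_top ENNReal.coe_ne_top (ENNReal.rpow_ne_top_of_nonneg hq0.le hD₂t))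
    (n₀ := n₀) (fun n _ => (hcD n).le) hbdq hη''0
  have mint : AEMeasurable (fun x => ‖H x‖ₑ ^ p + ENNReal.ofReal (a x) * ‖H x‖ₑ ^ q)
      (volume.restrict Ω) := AEMeasurable.dpEnergy_integrand p q ha hHm.aestronglyMeasurable
  refine ⟨fun x => c₀ * ((‖H x‖ₑ ^ p + ENNReal.ofReal (a x) * ‖H x‖ₑ ^ q) +
      (k₁ * M₁ + k₂ * (M₂ * B))), fun n x => c₀ * (k₁ * e₁ n x + k₂ * e₂ n x), ?_, ?_, ?_⟩
  · exact (mint.add_const _).const_mul _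
  · rw [lintegral_const_mul' _ _ hc₀t, lintegral_add_left' mint, lintegral_const,
      Measure.restrict_apply_univ]
    refine ENNReal.mul_ne_top hc₀t (ENNReal.add_ne_top.2 ⟨hfin.ne, ENNReal.mul_ne_top ?_
      hΩb.measure_lt_top.ne⟩)
    exact ENNReal.add_ne_top.2 ⟨ENNReal.mul_ne_top hk₁t hM₁,
      ENNReal.mul_ne_top hk₂t (ENNReal.mul_ne_top hM₂ ENNReal.coe_ne_top)⟩
  filter_upwards [Filter.eventually_ge_atTop n₀] with n hn
  refine ⟨?_, ?_⟩
  · filter_upwards [hpt n, hWB] with x hx hxB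
    have hsub : ∀ r : ℝ, 1 ≤ r → r ≤ q → ‖(H - gradient (φ n)) x‖ₑ ^ r ≤
        c₀ * (‖H x‖ₑ ^ r + ‖gradient (φ n) x‖ₑ ^ r) := fun r hr hrq => by
      have := rpow_enorm_add_le (H x) (-gradient (φ n) x) (w₁ := 2⁻¹) (w₂ := 2⁻¹) (by simp)
        (by simp) ENNReal.inv_two_add_inv_two hr hrq
      rw [enorm_neg, ← sub_eq_add_neg, ← mul_add] at this
      exact this
    have hh1 := (h₁ n hn).1 x
    have hh2 := (h₂ n hn).1 x
    rw [one_mul, mul_one] at hh1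
    calc ‖(H - gradient (φ n)) x‖ₑ ^ p + ENNReal.ofReal (a x) * ‖(H - gradient (φ n)) x‖ₑ ^ q
        ≤ c₀ * (‖H x‖ₑ ^ p + ‖gradient (φ n) x‖ₑ ^ p) + ENNReal.ofReal (a x) *
            (c₀ * (‖H x‖ₑ ^ q + ‖gradient (φ n) x‖ₑ ^ q)) :=
          add_le_add (hsub p hp hpq) (by gcongr; exact hsub q hq1.le le_rfl)
      _ = c₀ * ((‖H x‖ₑ ^ p + ENNReal.ofReal (a x) * ‖H x‖ₑ ^ q) +
            (‖gradient (φ n) x‖ₑ ^ p + ENNReal.ofReal (a x) * ‖gradient (φ n) x‖ₑ ^ q)) := by ring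
      _ ≤ c₀ * ((‖H x‖ₑ ^ p + ENNReal.ofReal (a x) * ‖H x‖ₑ ^ q) +
            (k₁ * (M₁ + e₁ n x) + k₂ * (M₂ * B + e₂ n x))) := by
          gcongr c₀ * (_ + ?_)
          refine hx.trans ?_
          gcongr
          exact hh2.trans (by gcongr)
      _ = _ := by ring
  · rw [lintegral_const_mul' _ _ hc₀t, lintegral_add_left ((me₁ n).const_mul _),
      lintegral_const_mul' _ _ hk₁t, lintegral_const_mul' _ _ hk₂t]
    calc c₀ * ((k₁ * ∫⁻ x in Ω, e₁ n x) + k₂ * ∫⁻ x in Ω, e₂ n x)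
        ≤ c₀ * (k₁ * η'' + k₂ * η'') := by
          gcongr
          · exact (h₁ n hn).2
          · exact (h₂ n hn).2
      _ = c₀ * (k₁ + k₂) * (η'' + 0) := by ring
      _ ≤ η := (hlt _ _ hη'' hη').le

/-! ### Localization on Lipschitz domains -/

theorem norm_sub_inner_smul_le {E : Type*} [NormedAddCommGroup E] [InnerProductSpace ℝ E]
    {e : E} (he : ‖e‖ = 1) (z : E) : ‖z - inner ℝ e z • e‖ ≤ ‖z‖ := by
  have h : ‖z - inner ℝ e z • e‖ ^ 2 = ‖z‖ ^ 2 - inner ℝ e z ^ 2 := by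
    rw [norm_sub_sq_real, inner_smul_right, norm_smul, he, real_inner_comm e z, Real.norm_eq_abs,
      mul_one, sq_abs]
    ring
  exact le_of_sq_le_sq (by rw [h]; linarith [sq_nonneg (inner ℝ e z)]) (norm_nonneg _)

/-- Near each point of its closure, a Lipschitz domain can be pushed into itself along a fixed
direction, with room proportional to the displacement. -/
theorem IsBoundedLipschitzDomain.exists_push {N : ℕ} {Ω : Set (Eucl N)}
    (hΩ : IsBoundedLipschitzDomain Ω) {x₀ : Eucl N} (hx₀ : x₀ ∈ closure Ω) :
    ∃ (r : ℝ) (e : Eucl N) (c t₀ : ℝ), 0 < r ∧ 0 < c ∧ 0 < t₀ ∧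
      ∀ y ∈ Ω ∩ ball x₀ r, ∀ t, 0 < t → t < t₀ → closedBall (y + t • e) (c * t) ⊆ Ω := by
  obtain ⟨hO, -, hL⟩ := hΩ
  rw [closure_eq_interior_union_frontier, hO.interior_eq] at hx₀
  rcases hx₀ with hx | hx
  · obtain ⟨r, hr, hsub⟩ := Metric.isOpen_iff.1 hO x₀ hx
    refine ⟨r / 2, 0, 1, r / 2, by positivity, one_pos, by positivity, ?_⟩
    rintro y ⟨-, hy⟩ t ht ht' z hz
    refine hsub ?_
    rw [smul_zero, add_zero, one_mul, mem_closedBall] at hz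
    rw [mem_ball] at hy ⊢
    linarith [dist_triangle z y x₀]
  · obtain ⟨e, γ, L, r, he, hγ, hr, hgraph⟩ := hL x₀ hx
    have hL1 : (0 : ℝ) < L + 1 := by positivity
    refine ⟨r / 2, e, ((L : ℝ) + 1)⁻¹, r / 4, by positivity, by positivity, by positivity, ?_⟩
    rintro y ⟨hyΩ, hy⟩ t ht ht' x hx'
    obtain ⟨z, rfl⟩ : ∃ z, x = y + t • e + z := ⟨x - (y + t • e), by abel⟩
    rw [mem_closedBall_iff_norm, add_sub_cancel_left, inv_mul_eq_div, le_div_iff₀ hL1] at hx'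
    have hz0 := norm_nonneg z
    have hzL : 0 ≤ ‖z‖ * L := by positivity
    have hzt : ‖z‖ ≤ t := by linarith
    have hyr : y ∈ ball x₀ r := ball_subset_ball (by linarith) hy
    have hxr : y + t • e + z ∈ ball x₀ r := by
      rw [mem_ball_iff_norm] at hy ⊢
      have e1 : y + t • e + z - x₀ = (y - x₀) + (t • e + z) := by abel
      have h1 : ‖t • e‖ = t := by rw [norm_smul, he, mul_one, Real.norm_of_nonneg ht.le]
      rw [e1]
      linarith [norm_add_le (y - x₀) (t • e + z), norm_add_le (t • e) z]
    have hy2 := (hgraph y hyr).1 hyΩ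
    refine (hgraph _ hxr).2 ?_
    have hin : inner ℝ e (y + t • e + z) = inner ℝ e y + t + inner ℝ e z := by
      rw [inner_add_right, inner_add_right, inner_smul_right, real_inner_self_eq_norm_sq, he]
      ring
    have hez : -‖z‖ ≤ inner ℝ e z := by
      have h1 := (abs_real_inner_le_norm e z)
      rw [he, one_mul] at h1
      exact (abs_le.1 h1).1
    have hP : y + t • e + z - (inner ℝ e y + t + inner ℝ e z) • e - (y - inner ℝ e y • e) =
        z - inner ℝ e z • e := by
      rw [add_smul, add_smul]; abel
    have hlip := hγ.dist_le_mul (y + t • e + z - (inner ℝ e y + t + inner ℝ e z) • e)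
      (y - inner ℝ e y • e)
    rw [dist_eq_norm, dist_eq_norm, hP, Real.norm_eq_abs] at hlip
    have h2 : (L : ℝ) * ‖z - inner ℝ e z • e‖ ≤ L * ‖z‖ :=
      mul_le_mul_of_nonneg_left (norm_sub_inner_smul_le he z) L.2
    rw [hin]
    have h3 := (abs_le.1 (hlip.trans h2)).2
    linarith

open scoped Manifold in
/-- A finite smooth partition of unity on a compact set, subordinate to balls with prescribed
radii. -/
theorem exists_partition_of_unity {N : ℕ} {K : Set (Eucl N)} (hK : IsCompact K)
    {r : Eucl N → ℝ} (hr : ∀ x ∈ K, 0 < r x) :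
    ∃ (t : Finset (Eucl N)) (θ : t → Eucl N → ℝ), (∀ i ∈ t, i ∈ K) ∧
      (∀ i, ContDiff ℝ (⊤ : ℕ∞) (θ i)) ∧ (∀ i x, 0 ≤ θ i x) ∧ (∀ i x, θ i x ≤ 1) ∧
      (∀ (i : t), ∀ x ∉ ball (i : Eucl N) (r i), θ i x = 0) ∧ ∀ x ∈ K, ∑ i, θ i x = 1 := by
  obtain ⟨t, htK, hcov⟩ := hK.elim_nhds_subcover (fun x => ball x (r x))
    fun x hx => ball_mem_nhds x (hr x hx)
  obtain ⟨f, hf⟩ := SmoothPartitionOfUnity.exists_isSubordinate 𝓘(ℝ, Eucl N) hK.isClosed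
    (fun i : t => ball (i : Eucl N) (r i)) (fun i => isOpen_ball) (by
      intro x hx
      obtain ⟨i, hi, hxi⟩ := mem_iUnion₂.1 (hcov hx)
      exact mem_iUnion.2 ⟨⟨i, hi⟩, hxi⟩)
  refine ⟨t, fun i => f i, htK, fun i => (f i).contMDiff.contDiff, fun i x => f.nonneg i x,
    fun i x => f.le_one i x, fun i x hx => ?_, fun x hx => ?_⟩
  · exact image_eq_zero_of_notMem_tsupport fun h => hx (hf i h)
  · have := f.sum_eq_one hx
    rwa [finsum_eq_sum_of_fintype] at this

theorem IsWeakGradient.congr_gradient {N : ℕ} {Ω : Set (Eucl N)} {u : Eucl N → ℝ}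
    {G H : Eucl N → Eucl N} (h : IsWeakGradient Ω u G) (hGH : G =ᵐ[volume] H) :
    IsWeakGradient Ω u H := by
  refine ⟨h.1, fun x hx => ?_, fun φ hφ i => ?_⟩
  · obtain ⟨s, hs, hi⟩ := h.2.1 x hx
    exact ⟨s, hs, hi.congr_fun_ae (ae_restrict_of_ae hGH)⟩
  · rw [h.2.2 φ hφ i]
    congr 1
    refine integral_congr_ae ?_
    filter_upwards [ae_restrict_of_ae hGH] with x hx
    rw [hx]

theorem dpEnergy_lt_top_of_bounded {N : ℕ} {Ω : Set (Eucl N)} (hΩb : Bornology.IsBounded Ω)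
    {a : Eucl N → ℝ} {p q : ℝ} (hp : 0 ≤ p) (hq : 0 ≤ q) {A M : ℝ≥0}
    (hA : ∀ᵐ x ∂volume.restrict Ω, ENNReal.ofReal (a x) ≤ A) {G : Eucl N → Eucl N}
    (hG : ∀ᵐ x ∂volume.restrict Ω, ‖G x‖ₑ ≤ M) : dpEnergy Ω a p q G < ∞ := by
  have hle : dpEnergy Ω a p q G ≤
      ∫⁻ x in Ω, ((M : ℝ≥0∞) ^ p + (A : ℝ≥0∞) * (M : ℝ≥0∞) ^ q) := by
    refine lintegral_mono_ae ?_
    filter_upwards [hA, hG] with x h1 h2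
    gcongr
  refine hle.trans_lt ?_
  rw [lintegral_const, Measure.restrict_apply_univ]
  refine ENNReal.mul_lt_top (ENNReal.add_lt_top.2
    ⟨(ENNReal.rpow_ne_top_of_nonneg hp ENNReal.coe_ne_top).lt_top,
    ENNReal.mul_lt_top ENNReal.coe_lt_top
      (ENNReal.rpow_ne_top_of_nonneg hq ENNReal.coe_ne_top).lt_top⟩) hΩb.measure_lt_top

theorem exists_ae_bound_weight {N : ℕ} {κ : ℝ} (hκ : 0 < κ) {Ω : Set (Eucl N)}
    (hO : MeasurableSet Ω) (hb : Bornology.IsBounded Ω) {a σ ω : Eucl N → ℝ}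
    (ha : ∀ x ∈ Ω, a x = σ x * ω x) (hσ : MemZ κ Ω σ) {B : ℝ≥0}
    (hB : ∀ᵐ x ∂volume.restrict Ω, ‖ω x‖ₑ ≤ B) :
    ∃ A : ℝ≥0, ∀ᵐ x ∂volume.restrict Ω, ENNReal.ofReal (a x) ≤ A := by
  obtain ⟨S, hS0, hS⟩ := hσ.exists_bound hκ hb
  refine ⟨S.toNNReal * B, ?_⟩
  filter_upwards [hB, ae_restrict_mem hO] with x hx hxΩ
  rw [ha x hxΩ, ENNReal.ofReal_mul (hσ.1 x hxΩ), ENNReal.coe_mul]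
  refine mul_le_mul' (ENNReal.ofReal_le_ofReal (hS x hxΩ)) (le_trans ?_ hx)
  rw [← ofReal_norm]
  exact ENNReal.ofReal_le_ofReal (Real.le_norm_self _)

theorem sum_gradient_eq_zero {N : ℕ} {ι : Type*} [Fintype ι] {θ : ι → Eucl N → ℝ}
    (hθ : ∀ i, ContDiff ℝ 1 (θ i)) {Ω : Set (Eucl N)} (hΩ : IsOpen Ω)
    (h1 : ∀ x ∈ Ω, ∑ i, θ i x = 1) {x : Eucl N} (hx : x ∈ Ω) : ∑ i, gradient (θ i) x = 0 := by
  have hd : fderiv ℝ (fun y => ∑ i, θ i y) x = 0 := by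
    have he : (fun y => ∑ i, θ i y) =ᶠ[nhds x] fun _ => (1 : ℝ) := by
      filter_upwards [hΩ.mem_nhds hx] with y hy using h1 y hy
    rw [he.fderiv_eq]
    simp
  have hs : fderiv ℝ (fun y => ∑ i, θ i y) x = ∑ i, fderiv ℝ (θ i) x :=
    fderiv_fun_sum fun i _ => (hθ i).differentiable one_ne_zero x
  simp only [gradient]
  rw [← map_sum, ← hs, hd, map_zero]

/-- Approximation of bounded functions by localization with a partition of unity. -/
theorem approxByTest_of_bounded {N : ℕ} (hN : 1 ≤ N) {Ω U : Set (Eucl N)}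
    (hΩ : IsBoundedLipschitzDomain Ω) (hU : IsOpen U) (hΩU : closure Ω ⊆ U)
    {p q κ : ℝ} (hp : 1 ≤ p) (hpq : p ≤ q) (hq1 : 1 < q) (hκ : 0 < κ)
    (hq : q ≤ p + κ * max 1 (p / N)) {a σ ω : Eucl N → ℝ}
    (ha_meas : AEMeasurable a (volume.restrict Ω)) (ha : ∀ x ∈ Ω, a x = σ x * ω x)
    (hσ : MemZ κ Ω σ) (hω : MemMuckenhoupt q U ω) {B : ℝ≥0}
    (hB : ∀ᵐ x ∂volume.restrict Ω, ‖ω x‖ₑ ≤ B) {w : Eucl N → ℝ} {H : Eucl N → Eucl N}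
    {M : ℝ} (hw : IsWeakGradient univ w H) (hM : ∀ x, |w x| ≤ M)
    (hw0 : ∀ x ∉ Ω, w x = 0) (hH0 : ∀ x ∉ Ω, H x = 0)
    (hfin : dpEnergy Ω a p q H < ∞) : ApproxByTest Ω a p q H := by
  have hO : IsOpen Ω := hΩ.1
  have hb : Bornology.IsBounded Ω := hΩ.2.1
  have hM0 : 0 ≤ M := (abs_nonneg _).trans (hM 0)
  obtain ⟨C, s, hC, hsm, hs, hσC⟩ := hσ.exists_measurable hκ
  obtain ⟨W, K, hW, hWt, hK, hWω⟩ := hω.exists_measurable hq1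
  have hWω' : ∀ᵐ x ∂volume.restrict Ω, W x = ENNReal.ofReal (ω x) :=
    ae_restrict_of_ae_restrict_of_subset (subset_closure.trans hΩU) hWω
  have haW : ∀ᵐ x ∂volume.restrict Ω, ENNReal.ofReal (a x) = ENNReal.ofReal (σ x) * W x := by
    filter_upwards [hWω', ae_restrict_mem hO.measurableSet] with x hx hxΩ
    rw [ha x hxΩ, hx, ENNReal.ofReal_mul (hσ.1 x hxΩ)]
  have hWB : ∀ᵐ x ∂volume.restrict Ω, W x ≤ B := by
    filter_upwards [hWω', hB] with x hx hxB
    rw [hx]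
    refine le_trans ?_ hxB
    rw [← ofReal_norm]
    exact ENNReal.ofReal_le_ofReal (Real.le_norm_self _)
  obtain ⟨A, hA⟩ := exists_ae_bound_weight hκ hO.measurableSet hb ha hσ hB
  obtain ⟨ρ₀, hρ₀, hthick⟩ := hb.isCompact_closure.exists_thickening_subset_open hU hΩU
  have hΩU' : ∀ y ∈ Ω, ball y ρ₀ ⊆ U := fun y hy =>
    (ball_subset_thickening (subset_closure hy) ρ₀).trans hthick
  have hex : ∀ x₀ : Eucl N, ∃ (r : ℝ) (e : Eucl N) (c t₀ : ℝ), x₀ ∈ closure Ω →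
      (0 < r ∧ 0 < c ∧ 0 < t₀ ∧
        ∀ y ∈ Ω ∩ ball x₀ r, ∀ t, 0 < t → t < t₀ → closedBall (y + t • e) (c * t) ⊆ Ω) := by
    intro x₀
    by_cases h : x₀ ∈ closure Ω
    · obtain ⟨r, e, c, t₀, h'⟩ := hΩ.exists_push h
      exact ⟨r, e, c, t₀, fun _ => h'⟩
    · exact ⟨0, 0, 0, 0, fun h' => absurd h' h⟩
  choose r e c t₀ hpush using hex
  obtain ⟨T, θ, hTK, hθ, hθ0, hθ1, hθs, hsum⟩ :=
    exists_partition_of_unity hb.isCompact_closure (r := r) fun x hx => (hpush x hx).1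
  have hθC1 : ∀ i, ContDiff ℝ 1 (θ i) := fun i => (hθ i).of_le (by exact_mod_cast le_top)
  have hwi : ∀ i, IsWeakGradient univ (fun x => θ i x * w x)
      (fun x => θ i x • H x + w x • gradient (θ i) x) := fun i => hw.smooth_mul (hθ i)
  have hHmeas : AEStronglyMeasurable H :=
    (locallyIntegrableOn_univ.1 hw.2.1).aestronglyMeasurable
  have hwmeas : AEStronglyMeasurable w :=
    (locallyIntegrableOn_univ.1 hw.1).aestronglyMeasurable
  have hmeas : ∀ i, AEStronglyMeasurable (fun x => θ i x • H x + w x • gradient (θ i) x) :=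
    fun i => ((hθ i).continuous.aestronglyMeasurable.smul hHmeas).add
      (hwmeas.smul (hθC1 i).continuous_gradient.aestronglyMeasurable)
  -- a Borel representative that vanishes outside `Ω`
  set Hi : T → Eucl N → Eucl N := fun i => Ω.indicator ((hmeas i).mk _) with hHi
  have hHi_ae : ∀ i, (fun x => θ i x • H x + w x • gradient (θ i) x) =ᵐ[volume] Hi i := by
    intro i
    filter_upwards [(hmeas i).ae_eq_mk] with x hx
    by_cases hxΩ : x ∈ Ω
    · simp only [hHi]
      rw [indicator_of_mem hxΩ, ← hx]
    · simp only [hHi, indicator_of_notMem hxΩ, hH0 x hxΩ, hw0 x hxΩ, smul_zero, zero_smul,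
        add_zero]
  have hHim : ∀ i, Measurable (Hi i) := fun i =>
    (hmeas i).stronglyMeasurable_mk.measurable.indicator hO.measurableSet
  have hloc : ∀ i, ApproxByTest Ω a p q (Hi i) := by
    intro i
    obtain ⟨-, hc, ht₀, hpu⟩ := hpush i (hTK i i.2)
    refine approxByTest_of_push hN hO hb hp hpq hq1 hκ hq ha_meas hC hsm hs hσC hW hWt hK haW
      hWB hρ₀ hΩU' ((hwi i).congr_gradient (hHi_ae i)) (M := M) (fun x => ?_)
      (S := Ω ∩ ball (i : Eucl N) (r i)) inter_subset_left (fun x hx => ?_) (hHim i)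
      (fun x hx => indicator_of_notMem hx _) hc ht₀ hpu ?_
    · rw [abs_mul, abs_of_nonneg (hθ0 i x)]
      exact (mul_le_of_le_one_left (abs_nonneg _) (hθ1 i x)).trans (hM x)
    · by_cases hxΩ : x ∈ Ω
      · rw [hθs i x fun h => hx ⟨hxΩ, h⟩, zero_mul]
      · rw [hw0 x hxΩ, mul_zero]
    · rw [← dpEnergy_congr (ae_restrict_of_ae (hHi_ae i))]
      have h1 : dpEnergy Ω a p q (fun x => θ i x • H x) < ∞ := by
        refine lt_of_le_of_lt (dpEnergy_mono (by linarith) (by linarith)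
          (Filter.Eventually.of_forall fun x => ?_)) hfin
        rw [enorm_smul]
        refine mul_le_of_le_one_left' ?_
        rw [← ofReal_norm, Real.norm_of_nonneg (hθ0 i x)]
        exact ENNReal.ofReal_le_one.2 (hθ1 i x)
      have h2 : dpEnergy Ω a p q (fun x => w x • gradient (θ i) x) < ∞ := by
        obtain ⟨L, hL⟩ := hb.isCompact_closure.exists_bound_of_continuousOn
          (hθC1 i).continuous_gradient.continuousOn
        refine dpEnergy_lt_top_of_bounded hb (by linarith) (by linarith) hA
          (M := (M * L).toNNReal) ?_
        filter_upwards [ae_restrict_mem hO.measurableSet] with x hx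
        rw [← ofReal_norm, norm_smul]
        refine ENNReal.ofReal_le_ofReal ?_
        exact mul_le_mul (hM x) (hL x (subset_closure hx)) (norm_nonneg _) hM0
      exact (dpEnergy_add_le_two_mul hp hpq ha_meas
        ((hθ i).continuous.aestronglyMeasurable.smul hHmeas).restrict).trans_lt
        (ENNReal.mul_lt_top (two_inv_rpow_ne_top _).lt_top (ENNReal.add_lt_top.2 ⟨h1, h2⟩))
  refine (ApproxByTest.sum hp hpq ha_meas Finset.univ
    (fun i => (hHim i).aestronglyMeasurable) hloc).congr ?_
  filter_upwards [ae_restrict_of_ae (ae_all_iff.2 hHi_ae), ae_restrict_mem hO.measurableSet]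
    with x hx hxΩ
  rw [Finset.sum_apply]
  simp only [← hx]
  rw [Finset.sum_add_distrib, ← Finset.sum_smul, ← Finset.smul_sum,
    hsum x (subset_closure hxΩ), one_smul,
    sum_gradient_eq_zero hθC1 hO (fun y hy => hsum y (subset_closure hy)) hxΩ, smul_zero, add_zero]

/-- In the linear case `p = q = 1` the energy is controlled by the norm of `W^{1,1}`. -/
theorem approxByTest_of_eq_one {N : ℕ} {Ω : Set (Eucl N)} (hΩ : IsOpen Ω) {a : Eucl N → ℝ}
    {A : ℝ≥0} (hA : ∀ᵐ x ∂volume.restrict Ω, ENNReal.ofReal (a x) ≤ A) {v : Eucl N → ℝ}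
    {G : Eucl N → Eucl N} (hv : MemW11Zero Ω v) (hG : IsWeakGradient Ω v G) :
    ApproxByTest Ω a 1 1 G := by
  intro ε hε
  obtain ⟨φ, hφ, -, hlim, -⟩ := hv.exists_seq hΩ hG
  have h1 : Filter.Tendsto (fun n => (1 + A : ℝ≥0∞) * ∫⁻ x in Ω, ‖gradient (φ n) x - G x‖ₑ)
      Filter.atTop (nhds 0) := by
    have := ENNReal.Tendsto.const_mul (a := (1 + A : ℝ≥0∞)) hlim (Or.inr (by simp))
    rwa [mul_zero] at this
  obtain ⟨n, hn⟩ := (h1.eventually (gt_mem_nhds hε)).exists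
  refine ⟨φ n, hφ n, lt_of_le_of_lt ?_ hn⟩
  rw [lintegral_enorm_sub_comm, ← lintegral_const_mul' _ _ (by simp)]
  refine lintegral_mono_ae ?_
  filter_upwards [hA] with x hx
  rw [ENNReal.rpow_one, add_mul, one_mul]
  exact add_le_add le_rfl (mul_le_mul' hx le_rfl)

/-- Weak gradients of functions in `W^{1,1}_0(Ω)` of finite energy are limits in energy of
gradients of test functions. -/
theorem MemW11Zero.approxByTest {N : ℕ} (hN : 1 ≤ N) {Ω U : Set (Eucl N)}
    (hΩ : IsBoundedLipschitzDomain Ω) (hU : IsOpen U) (hΩU : closure Ω ⊆ U)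
    {p q κ : ℝ} (hp : 1 ≤ p) (hpq : p ≤ q) (hκ : 0 < κ)
    (hq : q ≤ p + κ * max 1 (p / N)) {a σ ω : Eucl N → ℝ}
    (ha_meas : AEMeasurable a (volume.restrict Ω)) (ha : ∀ x ∈ Ω, a x = σ x * ω x)
    (hσ : MemZ κ Ω σ) (hω : 1 < q → MemMuckenhoupt q U ω)
    (hω_bdd : MemLp ω ∞ (volume.restrict Ω)) {v : Eucl N → ℝ} {G : Eucl N → Eucl N}
    (hv : MemW11Zero Ω v) (hG : IsWeakGradient Ω v G) (hGi : IntegrableOn G Ω)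
    (hfin : dpEnergy Ω a p q G < ∞) : ApproxByTest Ω a p q G := by
  have hO : IsOpen Ω := hΩ.1
  obtain ⟨B, hB⟩ : ∃ B : ℝ≥0, ∀ᵐ x ∂volume.restrict Ω, ‖ω x‖ₑ ≤ B := by
    have h2 := hω_bdd.2
    rw [eLpNorm_exponent_top] at h2
    refine ⟨(eLpNormEssSup ω (volume.restrict Ω)).toNNReal, ?_⟩
    rw [ENNReal.coe_toNNReal h2.ne]
    exact ae_le_eLpNormEssSup
  rcases (hp.trans hpq).eq_or_lt with hq1 | hq1
  · obtain rfl : p = 1 := le_antisymm (by linarith) hp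
    obtain rfl : q = 1 := hq1.symm
    obtain ⟨A, hA⟩ := exists_ae_bound_weight hκ hO.measurableSet hΩ.2.1 ha hσ hB
    exact approxByTest_of_eq_one hO hA hv hG
  have hvm : AEStronglyMeasurable v (volume.restrict Ω) := hv.1.1.aestronglyMeasurable
  have hGm : AEStronglyMeasurable G (volume.restrict Ω) := hGi.aestronglyMeasurable
  refine ApproxByTest.of_forall_exists hp hpq ha_meas hGm fun ε hε => ?_
  obtain ⟨n, hn⟩ := ((tendsto_dpEnergy_truncation (by linarith : 0 < p) (by linarith : 0 < q)
    ha_meas hvm hGm hfin).eventually (gt_mem_nhds hε)).exists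
  have hk : (0 : ℝ) < n + 1 := by positivity
  set τ := arctanTrunc ((n : ℝ) + 1) with hτ
  have hτ' : ∀ s, |deriv τ s| ≤ 1 := fun s => by
    have := deriv_arctanTrunc_mem hk s
    rw [abs_of_nonneg this.1]
    exact this.2
  have hτ0 : τ 0 = 0 := by simp [hτ, arctanTrunc]
  refine ⟨fun x => deriv τ (v x) • G x,
    (((contDiff_arctanTrunc _).continuous_deriv le_rfl).comp_aestronglyMeasurable hvm).smul hGm,
    ?_, hn⟩
  have hae : Ω.indicator (fun x => deriv τ (v x) • G x) =ᵐ[volume.restrict Ω]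
      fun x => deriv τ (v x) • G x := indicator_ae_eq_restrict hO.measurableSet
  refine ApproxByTest.congr ?_ hae
  refine approxByTest_of_bounded hN hΩ hU hΩU hp hpq hq1 hκ hq ha_meas ha hσ (hω hq1) hB
    (hv.isWeakGradient_indicator_comp hO hG hGi (contDiff_arctanTrunc _) hτ0 hτ')
    (M := ((n : ℝ) + 1) * 2) (fun x => ?_) (fun x hx => indicator_of_notMem hx _)
    (fun x hx => indicator_of_notMem hx _) ?_
  · by_cases hx : x ∈ Ω
    · rw [indicator_of_mem hx]
      exact abs_arctanTrunc_le hk _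
    · rw [indicator_of_notMem hx, abs_zero]
      positivity
  · rw [dpEnergy_congr hae]
    refine lt_of_le_of_lt (dpEnergy_mono (by linarith) (by linarith)
      (Filter.Eventually.of_forall fun x => ?_)) hfin
    rw [enorm_smul]
    refine mul_le_of_le_one_left' ?_
    rw [← ofReal_norm]
    exact ENNReal.ofReal_le_one.2 (hτ' _)

theorem mainTheorem3 {N : ℕ} (hN : 1 ≤ N) (Ω U : Set (Eucl N))
    (hΩ : IsBoundedLipschitzDomain Ω) (hU : IsOpen U) (hΩU : closure Ω ⊆ U)
    (p q κ : ℝ) (hp : 1 ≤ p) (hpq : p ≤ q) (hκ : 0 < κ)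
    (hq : q ≤ p + κ * max 1 (p / N))
    (a σ ω : Eucl N → ℝ)
    (ha_meas : AEMeasurable a (volume.restrict Ω)) (ha_nonneg : ∀ x ∈ Ω, 0 ≤ a x)
    (ha : ∀ x ∈ Ω, a x = σ x * ω x)
    (hσ : MemZ κ Ω σ)
    (hω : 1 < q → MemMuckenhoupt q U ω) (hω_bdd : MemLp ω ∞ (volume.restrict Ω))
    (u₀ : Eucl N → ℝ) (hu₀ : MemW11 Ω u₀) (hu₀_fin : doublePhase Ω a p q u₀ < ∞) :
    (⨅ v ∈ {v : Eucl N → ℝ | MemW11Zero Ω v}, doublePhase Ω a p q (u₀ + v)) =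
      ⨅ φ ∈ {φ : Eucl N → ℝ | IsTestFunction Ω φ}, doublePhase Ω a p q (u₀ + φ) :=
  iInf_doublePhase_eq_of_approxByTest hΩ.1 hp hpq ha_meas ha_nonneg
    (fun _ _ hv hG hGi hfin => hv.approxByTest hN hΩ hU hΩU hp hpq hκ hq ha_meas ha hσ hω hω_bdd
      hG hGi hfin) hu₀ hu₀_fin
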